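/- Let $X$ be a complex Hilbert space with inner product $\langle\cdot,\cdot\rangle$ (linear in the first argument) and open unit ball $B=\{z\in X:\|z\|<1\}$, and let $0\le\alpha<1$. Let $K(B,\alpha)$ be the class of all locally biholomorphic mappings $f:B\to X$ with $f(0)=0$ and $Df(0)=I$ such that $$\|x\|^2-\mathrm{Re}\,\big\langle Df(z)^{-1}D^2f(z)(x,x),\,z\big\rangle>\alpha\|x\|^2$$ for all $z\in B\setminus\{0\}$ and $x\in X\setminus\{0\}$ with $\mathrm{Re}\,\langle x,z\rangle=0$. (Here $f$ is locally biholomorphic if every point of $B$ has a neighbourhood $U\subset B$, $U$ a domain, such that $f$ is holomorphic on $U$, $f(U)$ is a domain, and $f|_U$ has an inverse that is holomorphic on $f(U)$; holomorphic means complex Fréchet differentiable.) Put $$\beta=\beta(\alpha)=\frac{2\alpha-1+\sqrt{(2\alpha-1)^2+8}}{4}.$$ If $f\in K(B,\alpha)$, then for all $z\in B$ $$\frac{\|z\|}{(1+\|z\|)^{2(1-\beta)}}\le\|f(z)\|\le\frac{\|z\|}{(1-\|z\|)^{2(1-\beta)}},$$ and $f(B)\supset\{w\in X:\|w\|<2^{-2(1-\beta)}\}$.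 -/

import Mathlib

namespace HilbertConvex

/-- A domain: a non-empty connected open set. -/
def IsDomainSet {X : Type*} [TopologicalSpace X] (G : Set X) : Prop :=
  IsOpen G ∧ IsConnected G

/-- `f` is biholomorphic on the domain `G`: it is holomorphic (complex Fréchet differentiable)
on `G`, its image `f(G)` is a domain, and `f : G → f(G)` has an inverse which is holomorphic
on `f(G)`. Only the values of `f` on `G` matter. -/
def IsBiholomorphicOn {X : Type*} [NormedAddCommGroup X] [NormedSpace ℂ X]
    (f : X → X) (G : Set X) : Prop :=
  IsDomainSet G ∧ DifferentiableOn ℂ f G ∧ IsDomainSet (f '' G) ∧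
    ∃ g : X → X, DifferentiableOn ℂ g (f '' G) ∧ Set.LeftInvOn g f G

/-- `f` is locally biholomorphic on `G`: every point of `G` has a neighbourhood inside `G` on
which `f` is biholomorphic. -/
def IsLocallyBiholomorphicOn {X : Type*} [NormedAddCommGroup X] [NormedSpace ℂ X]
    (f : X → X) (G : Set X) : Prop :=
  ∀ z ∈ G, ∃ U : Set X, z ∈ U ∧ U ⊆ G ∧ IsBiholomorphicOn f U

/-- `f` is a biholomorphic convex mapping of order `α` on the open unit ball `B` of the complex
Hilbert space `X`: it is locally biholomorphic on `B`, and
`‖x‖² - Re ⟨Df(z)⁻¹ D²f(z)(x, x), z⟩ > α ‖x‖²` whenever `z ∈ B \ {0}`, `x ≠ 0` and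
`Re ⟨x, z⟩ = 0`. Mathlib's inner product is linear in its second argument, hence
`⟨a, z⟩` is `inner ℂ z a`. As `f` is locally biholomorphic, `fderiv ℂ f z` is invertible for
`z ∈ B`, and `ContinuousLinearMap.inverse` is its genuine inverse. -/
def IsConvexOfOrder {X : Type*} [NormedAddCommGroup X] [InnerProductSpace ℂ X]
    (α : ℝ) (f : X → X) : Prop :=
  IsLocallyBiholomorphicOn f (Metric.ball (0 : X) 1) ∧
    ∀ z ∈ Metric.ball (0 : X) 1, z ≠ 0 → ∀ x : X, x ≠ 0 → (inner ℂ z x).re = 0 →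
      α * ‖x‖ ^ 2 <
        ‖x‖ ^ 2 -
          (inner ℂ z ((fderiv ℂ f z).inverse (fderiv ℂ (fderiv ℂ f) z x x))).re

/-- The class `K(B, α)`: biholomorphic convex mappings of order `α` on the open unit ball,
normalized by `f(0) = 0` and `Df(0) = I`. -/
def classK (X : Type*) [NormedAddCommGroup X] [InnerProductSpace ℂ X] (α : ℝ) :
    Set (X → X) :=
  {f | IsConvexOfOrder α f ∧ f 0 = 0 ∧ fderiv ℂ f 0 = ContinuousLinearMap.id ℂ X}

/-- The number `β(α) = (2α - 1 + √((2α - 1)² + 8)) / 4`. -/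
noncomputable def betaOrder (α : ℝ) : ℝ :=
  (2 * α - 1 + Real.sqrt ((2 * α - 1) ^ 2 + 8)) / 4

end HilbertConvex

open Metric Set Filter Topology

namespace HilbertConvex

/-! ### Holomorphic maps between Banach spaces: Cauchy estimates and regularity of the derivative.
-/

section Holomorphic

variable {E F : Type*} [NormedAddCommGroup E] [NormedSpace ℂ E] [NormedAddCommGroup F]
  [NormedSpace ℂ F]

/-! Write `w(z) = Df(z)⁻¹ f(z)`, `T = Df(z)⁻¹ D²f(z)` and `p = ⟨w(z), z⟩ / ‖z‖²`. The core is that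
`f` is starlike of order `β`: `p` lies in the disc `β |p|² ≤ Re p` (`starForm_nonpos`). Growth and
covering then follow from the flow of `w`, along which `f` is multiplied by an exponential.

Starlikeness is a continuity argument in the radius. Near `0` the disc condition holds since `w(z) ≈
z`. Suppose it holds on the closed ball of radius `r`. As in Jack's lemma, if `p` touched the
boundary circle at a point `z` of the sphere, the derivative of the disc condition would vanish in
the directions `iz`, `v`, `iv`, where `v` is the part of `w` orthogonal to `z`, and Schwarz's lemma
would bound the radial derivative. Since `Dw(z)x = x - T(w, x)`, these are statements about `⟨T(w,
·), z⟩`, and they contradict convexity (`norm_inner_bilin_le`, `jack_algebra`). The quadratic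
equation for `β` is what makes the constants meet.

In infinite dimension the sphere is not compact, so a contact point need not exist. The contact
conditions are therefore replaced by inequalities with an `O(θ²)` error, uniform on the sphere. They
confine finitely many scalars to a compact set (`firstOrderData`), on which strict negativity
becomes a uniform gap (`exists_firstOrderData_le`), and the radius can be increased. The uniform
constants need `w` bounded on smaller balls; this too comes from convexity, through a bound on `T`
and Grönwall's inequality.

For growth, Schwarz's lemma gives two-sided bounds for `Re ⟨w(z), z⟩`. Along `γ' = -w(γ)` one has
`f(γ(t)) = e⁻ᵗ f(γ(0))`, while `t + log(‖γ‖ / (1 ± ‖γ‖)^(2(1-β)))` increases for `+` and decreases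
for `-`; near `0`, `f` is tangent to the identity. For covering, the lower growth bound keeps
preimages away from the unit sphere, so the outward flow runs for a uniform time. -/

theorem norm_fderiv_le_of_bounded {f : E → F} {c : E} {R M : ℝ} (hR : 0 < R)
    (hd : DifferentiableOn ℂ f (ball c R)) (hM : ∀ z ∈ ball c R, ‖f z‖ ≤ M) :
    ‖fderiv ℂ f c‖ ≤ 2 * M / R := by
  refine Complex.norm_fderiv_le_div_of_mapsTo_ball hd (fun z hz => ?_) hR
  rw [mem_closedBall, dist_eq_norm]
  linarith [norm_sub_le (f z) (f c), hM z hz, hM c (mem_ball_self hR)]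

/-- A second-order Schwarz lemma: once its linear part is removed, `f` deviates from `f c` by at
most `4M` and vanishes to order two at the centre. -/
theorem norm_sub_sub_fderiv_le {f : E → F} {c h : E} {R M : ℝ}
    (hd : DifferentiableOn ℂ f (ball c R)) (hM : ∀ z ∈ ball c R, ‖f z‖ ≤ M) (hh : ‖h‖ < R) :
    ‖f (c + h) - f c - fderiv ℂ f c h‖ ≤ 4 * M * (‖h‖ / R) ^ 2 := by
  have hR : 0 < R := (norm_nonneg h).trans_lt hh
  have hfc := (hd.differentiableAt (ball_mem_nhds c hR)).hasFDerivAt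
  set g : E → F := fun z => f z - fderiv ℂ f c (z - c) with hg
  have hgd : DifferentiableOn ℂ g (ball c R) := by
    apply hd.sub
    exact ((fderiv ℂ f c).differentiable.comp (differentiable_id.sub_const c)).differentiableOn
  have hgc : g c = f c := by simp [hg]
  have hmaps : MapsTo g (ball c R) (closedBall (g c) (4 * M)) := by
    intro z hz
    rw [mem_closedBall, dist_eq_norm, hgc]
    have h1 := (fderiv ℂ f c).le_opNorm (z - c)
    have h2 := norm_fderiv_le_of_bounded hR hd hM
    have hz' : ‖z - c‖ < R := by rwa [mem_ball, dist_eq_norm] at hz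
    have h3 : ‖fderiv ℂ f c‖ * ‖z - c‖ ≤ 2 * M / R * R :=
      mul_le_mul h2 hz'.le (norm_nonneg _) ((norm_nonneg _).trans h2)
    rw [div_mul_cancel₀ _ hR.ne'] at h3
    have h4 : g z - f c = f z - f c - fderiv ℂ f c (z - c) := by simp only [hg]; abel
    rw [h4]
    linarith [norm_sub_le (f z - f c) (fderiv ℂ f c (z - c)), norm_sub_le (f z) (f c), hM z hz,
      hM c (mem_ball_self hR)]
  have hlo : (g · - g c) =o[𝓝 c] (fun w ↦ ‖w - c‖ ^ 1) := by
    have := hfc.isLittleO.norm_right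
    refine (this.congr_left fun w => ?_).congr_right fun w => (pow_one _).symm
    rw [hgc]; simp only [hg]; abel
  have := Complex.dist_le_mul_div_pow_of_mapsTo_ball_of_isLittleO hgd hmaps hlo
    (z := c + h) (by simpa [mem_ball, dist_eq_norm] using hh)
  rw [dist_eq_norm, dist_eq_norm, hgc] at this
  simp only [hg, add_sub_cancel_left] at this
  convert! this using 2
  abel

theorem exists_bound_near {f : E → F} {U : Set E} (hU : IsOpen U) (hd : DifferentiableOn ℂ f U)
    {c : E} (hc : c ∈ U) : ∃ R > 0, ∃ M, ball c R ⊆ U ∧ ∀ z ∈ ball c R, ‖f z‖ ≤ M := by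
  have hcont := (hd.continuousOn.continuousAt (hU.mem_nhds hc)).norm
  have h1 : ∀ᶠ z in 𝓝 c, ‖f z‖ < ‖f c‖ + 1 := hcont.eventually_lt_const (by linarith)
  obtain ⟨R, hR, h⟩ := Metric.eventually_nhds_iff_ball.1 (h1.and (hU.mem_nhds hc))
  exact ⟨R, hR, ‖f c‖ + 1, fun z hz => (h z hz).2, fun z hz => (h z hz).1.le⟩

/-- Uniformity in `ζ` is what allows differentiation in `ζ` to pass to the limit `t → 0`; it holds
because the quadratic remainder has the same constants at all centres `c + ζ • h`. -/
theorem tendstoUniformlyOn_difference_quotient {f : E → F} {c h v : E} {R M r : ℝ}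
    (hd : DifferentiableOn ℂ f (ball c (2 * R))) (hM : ∀ z ∈ ball c (2 * R), ‖f z‖ ≤ M)
    (hr : ‖h‖ * r ≤ R) (hR : 0 < R) :
    TendstoUniformlyOn (fun (t : ℂ) (ζ : ℂ) => t⁻¹ • (f (c + ζ • h + t • v) - f (c + ζ • h)))
      (fun ζ => fderiv ℂ f (c + ζ • h) v) (𝓝[≠] 0) (ball 0 r) := by
  rw [Metric.tendstoUniformlyOn_iff]
  intro ε hε
  have hM0 : 0 ≤ M := (norm_nonneg _).trans (hM c (mem_ball_self (by linarith)))
  have ht : ∀ᶠ t : ℂ in 𝓝 0, ‖t • v‖ < R ∧ 4 * M * ‖t‖ * (‖v‖ / R) ^ 2 < ε := by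
    have h1 : Tendsto (fun t : ℂ => ‖t • v‖) (𝓝 0) (𝓝 0) := by
      have : Continuous (fun t : ℂ => ‖t • v‖) := by fun_prop
      simpa using this.tendsto 0
    have h2 : Tendsto (fun t : ℂ => 4 * M * ‖t‖ * (‖v‖ / R) ^ 2) (𝓝 0) (𝓝 0) := by
      have : Continuous (fun t : ℂ => 4 * M * ‖t‖ * (‖v‖ / R) ^ 2) := by fun_prop
      simpa using this.tendsto 0
    exact (h1.eventually_lt_const hR).and (h2.eventually_lt_const hε)
  filter_upwards [ht.filter_mono nhdsWithin_le_nhds, self_mem_nhdsWithin] with t ⟨ht1, ht2⟩ ht0 ζ hζ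
  have ht0 : t ≠ 0 := ht0
  have hζ' : ‖ζ • h‖ ≤ R := by
    rw [norm_smul, mul_comm]
    rw [mem_ball_zero_iff] at hζ
    exact (mul_le_mul_of_nonneg_left hζ.le (norm_nonneg _)).trans hr
  have hsub : ball (c + ζ • h) R ⊆ ball c (2 * R) := by
    apply ball_subset_ball'
    rw [dist_eq_norm, add_sub_cancel_left]; linarith
  have key := norm_sub_sub_fderiv_le (hd.mono hsub) (fun z hz => hM z (hsub hz)) ht1
  have hpos : 0 < ‖t‖ := norm_pos_iff.2 ht0
  rw [dist_comm, dist_eq_norm]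
  have e : t⁻¹ • (f (c + ζ • h + t • v) - f (c + ζ • h)) - fderiv ℂ f (c + ζ • h) v =
      t⁻¹ • (f (c + ζ • h + t • v) - f (c + ζ • h) - fderiv ℂ f (c + ζ • h) (t • v)) := by
    rw [map_smul, smul_sub _ (f (c + ζ • h + t • v) - f (c + ζ • h)), inv_smul_smul₀ ht0]
  rw [e, norm_smul, norm_inv]
  calc ‖t‖⁻¹ * _ ≤ ‖t‖⁻¹ * (4 * M * (‖t • v‖ / R) ^ 2) := by gcongr
    _ = 4 * M * ‖t‖ * (‖v‖ / R) ^ 2 := by rw [norm_smul]; field_simp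
    _ < ε := ht2

theorem differentiableOn_fderiv_line [CompleteSpace F] {f : E → F} {c h v : E} {R M r : ℝ}
    (hd : DifferentiableOn ℂ f (ball c (2 * R))) (hM : ∀ z ∈ ball c (2 * R), ‖f z‖ ≤ M)
    (hr : ‖h‖ * r ≤ R) (hR : 0 < R) (hr0 : 0 < r) :
    DifferentiableOn ℂ (fun ζ : ℂ => fderiv ℂ f (c + ζ • h) v) (ball 0 r) ∧
    Tendsto (fun t : ℂ => deriv (fun ζ : ℂ =>
      t⁻¹ • (f (c + ζ • h + t • v) - f (c + ζ • h))) 0) (𝓝[≠] 0)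
      (𝓝 (deriv (fun ζ : ℂ => fderiv ℂ f (c + ζ • h) v) 0)) := by
  have hlim := (tendstoUniformlyOn_difference_quotient (v := v) hd hM hr hR).tendstoLocallyUniformlyOn
  have hdiff : ∀ᶠ t : ℂ in 𝓝[≠] 0, DifferentiableOn ℂ
      (fun ζ : ℂ => t⁻¹ • (f (c + ζ • h + t • v) - f (c + ζ • h))) (ball 0 r) := by
    have h1 : ∀ᶠ t : ℂ in 𝓝 0, ‖t • v‖ < R := by
      have : Continuous (fun t : ℂ => ‖t • v‖) := by fun_prop
      exact (by simpa using this.tendsto 0 : Tendsto _ _ (𝓝 (0 : ℝ))).eventually_lt_const hR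
    filter_upwards [h1.filter_mono nhdsWithin_le_nhds] with t ht
    have hmem : ∀ ζ ∈ ball (0 : ℂ) r, ‖ζ • h‖ ≤ R := by
      intro ζ hζ
      rw [norm_smul, mul_comm]
      rw [mem_ball_zero_iff] at hζ
      exact (mul_le_mul_of_nonneg_left hζ.le (norm_nonneg _)).trans hr
    refine DifferentiableOn.const_smul (DifferentiableOn.sub ?_ ?_) _
    · refine hd.comp (by fun_prop) fun ζ hζ => ?_
      rw [mem_ball, dist_eq_norm, add_assoc, add_sub_cancel_left]
      linarith [norm_add_le (ζ • h) (t • v), hmem ζ hζ]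
    · refine hd.comp (by fun_prop) fun ζ hζ => ?_
      rw [mem_ball, dist_eq_norm, add_sub_cancel_left]
      linarith [hmem ζ hζ]
  exact ⟨hlim.differentiableOn hdiff isOpen_ball,
    (hlim.deriv hdiff isOpen_ball).tendsto_at (mem_ball_self hr0)⟩

theorem hasDerivAt_line {f : E → F} {c h : E} {ζ : ℂ} (hd : DifferentiableAt ℂ f (c + ζ • h)) :
    HasDerivAt (fun ζ : ℂ => f (c + ζ • h)) (fderiv ℂ f (c + ζ • h) h) ζ := by
  have h1 : HasDerivAt (fun ζ : ℂ => c + ζ • h) h ζ := by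
    simpa using ((hasDerivAt_id ζ).smul_const h).const_add c
  exact hd.hasFDerivAt.comp_hasDerivAt ζ h1

/-- The derivative of a bounded holomorphic function is differentiable. -/
theorem differentiableAt_fderiv_of_bounded [CompleteSpace F] {f : E → F} {c : E} {R M : ℝ}
    (hR : 0 < R) (hd : DifferentiableOn ℂ f (ball c (2 * R)))
    (hM : ∀ z ∈ ball c (2 * R), ‖f z‖ ≤ M) : DifferentiableAt ℂ (fderiv ℂ f) c := by
  have hM0 : 0 ≤ M := (norm_nonneg _).trans (hM c (mem_ball_self (by linarith)))
  have hrad : ∀ h : E, 0 < R / (‖h‖ + 1) ∧ ‖h‖ * (R / (‖h‖ + 1)) ≤ R := by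
    intro h
    refine ⟨by positivity, ?_⟩
    rw [mul_div_assoc', div_le_iff₀ (by positivity)]
    nlinarith [norm_nonneg h]
  have hat : ∀ h v : E, DifferentiableAt ℂ (fun ζ : ℂ => fderiv ℂ f (c + ζ • h) v) 0 := fun h v =>
    (differentiableOn_fderiv_line hd hM (hrad h).2 hR (hrad h).1).1.differentiableAt
      (ball_mem_nhds _ (hrad h).1)
  -- The candidate second derivative, built one direction at a time. Linearity in `v` is immediate;
  -- linearity in `h` will come from symmetry.
  set A : E → E → F := fun h v => deriv (fun ζ : ℂ => fderiv ℂ f (c + ζ • h) v) 0 with hA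
  have hsymm : ∀ h v, A h v = A v h := by
    intro h v
    have h1 := (differentiableOn_fderiv_line (v := v) hd hM (hrad h).2 hR (hrad h).1).2
    have h2 := (hat v h).hasDerivAt.tendsto_slope_zero
    -- Both sides are the limit of `t⁻¹ (Df(c + tv)h - Df(c)h)`: one by exchanging limit and
    -- derivative, the other by definition.
    refine tendsto_nhds_unique h1 (h2.congr' ?_)
    have h3 : ∀ᶠ t : ℂ in 𝓝 0, ‖t • v‖ < R := by
      have : Continuous (fun t : ℂ => ‖t • v‖) := by fun_prop
      exact (by simpa using this.tendsto 0 : Tendsto _ _ (𝓝 (0 : ℝ))).eventually_lt_const hR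
    filter_upwards [h3.filter_mono nhdsWithin_le_nhds] with t ht
    have ha : DifferentiableAt ℂ f (c + t • v + (0 : ℂ) • h) := by
      refine hd.differentiableAt (isOpen_ball.mem_nhds ?_)
      rw [zero_smul, add_zero, mem_ball, dist_eq_norm, add_sub_cancel_left]; linarith
    have hb : DifferentiableAt ℂ f (c + (0 : ℂ) • h) := by
      refine hd.differentiableAt (isOpen_ball.mem_nhds ?_)
      rw [zero_smul, add_zero]; exact mem_ball_self (by linarith)
    have h4 := ((hasDerivAt_line ha).sub (hasDerivAt_line hb)).const_smul t⁻¹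
    have h5 : (fun ζ : ℂ => t⁻¹ • (f (c + ζ • h + t • v) - f (c + ζ • h))) =
        t⁻¹ • ((fun ζ : ℂ => f (c + t • v + ζ • h)) - fun ζ : ℂ => f (c + ζ • h)) := by
      funext ζ; simp [add_right_comm]
    rw [h5, h4.deriv]
    simp
  have hadd : ∀ h v v', A h (v + v') = A h v + A h v' := by
    intro h v v'
    simp only [hA, map_add]
    exact deriv_fun_add (hat h v) (hat h v')
  have hsmul : ∀ (k : ℂ) h v, A h (k • v) = k • A h v := by
    intro k h v
    simp only [hA, map_smul]
    exact deriv_fun_const_smul k (hat h v)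
  have hDf : ∀ z ∈ ball c R, ‖fderiv ℂ f z‖ ≤ 2 * M / R := by
    intro z hz
    have hsub : ball z R ⊆ ball c (2 * R) := by
      apply ball_subset_ball'; rw [mem_ball] at hz; linarith
    exact norm_fderiv_le_of_bounded hR (hd.mono hsub) fun y hy => hM y (hsub hy)
  have hline : ∀ h v : E, h ≠ 0 → DifferentiableOn ℂ (fun ζ : ℂ => fderiv ℂ f (c + ζ • h) v)
        (ball 0 (R / ‖h‖)) ∧
      ∀ ζ ∈ ball (0 : ℂ) (R / ‖h‖), ‖fderiv ℂ f (c + ζ • h) v‖ ≤ 2 * M / R * ‖v‖ := by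
    intro h v hh
    have hpos := norm_pos_iff.2 hh
    refine ⟨(differentiableOn_fderiv_line hd hM (by rw [mul_div_cancel₀ _ hpos.ne']) hR
      (by positivity)).1, fun ζ hζ => ?_⟩
    refine ((fderiv ℂ f _).le_opNorm v).trans ?_
    gcongr
    apply hDf
    rw [mem_ball_zero_iff, lt_div_iff₀ hpos] at hζ
    rw [mem_ball, dist_eq_norm, add_sub_cancel_left, norm_smul]; exact hζ
  have hbound : ∀ h v, ‖A h v‖ ≤ 4 * M / R ^ 2 * ‖h‖ * ‖v‖ := by
    intro h v
    rcases eq_or_ne h 0 with rfl | hh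
    · simp [hA]
    have hpos := norm_pos_iff.2 hh
    have := norm_fderiv_le_of_bounded (by positivity) (hline h v hh).1 (hline h v hh).2
    rw [← norm_deriv_eq_norm_fderiv] at this
    refine this.trans_eq ?_
    field_simp
    ring
  let L : E →L[ℂ] E →L[ℂ] F := LinearMap.mkContinuous₂ (LinearMap.mk₂ ℂ A
    (fun h h' v => by rw [hsymm, hadd, hsymm v, hsymm v]) (fun k h v => by
      rw [hsymm, hsmul, hsymm v]) hadd (fun k h v => hsmul k h v)) (4 * M / R ^ 2) hbound
  have hL : ∀ h v, L h v = A h v := fun h v => rfl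
  refine HasFDerivAt.differentiableAt (f' := L) ?_
  rw [hasFDerivAt_iff_isLittleO_nhds_zero]
  have hquad : (fun h => fderiv ℂ f (c + h) - fderiv ℂ f c - L h) =O[𝓝 0] fun h => ‖h‖ ^ 2 := by
    refine Asymptotics.IsBigO.of_bound (4 * (2 * M / R) / R ^ 2) ?_
    filter_upwards [ball_mem_nhds (0 : E) hR] with h hh
    rw [mem_ball_zero_iff] at hh
    refine ContinuousLinearMap.opNorm_le_bound _ (by positivity) fun v => ?_
    rcases eq_or_ne h 0 with rfl | h0
    · simp
    have hpos := norm_pos_iff.2 h0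
    -- The remainder in one complex variable on the line `ζ ↦ c + ζ • h`, taken at `ζ = 1` in a disc
    -- of radius `R / ‖h‖`, is quadratic in `h`.
    have := norm_sub_sub_fderiv_le (h := (1 : ℂ)) (hline h v h0).1 (hline h v h0).2
      (by rw [norm_one, lt_div_iff₀ hpos]; linarith)
    simp only [zero_add, one_smul, zero_smul, add_zero, fderiv_eq_smul_deriv] at this
    simp only [sub_apply, hL, hA]
    refine this.trans_eq ?_
    rw [norm_pow, norm_norm, norm_one]
    field_simp
  refine hquad.trans_isLittleO ?_
  have := Asymptotics.isLittleO_pow_id (𝕜 := ℝ) (n := 2) one_lt_two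
  exact (this.comp_tendsto (tendsto_norm_zero (E := E))).of_norm_right

theorem differentiableOn_fderiv [CompleteSpace F] {f : E → F} {U : Set E} (hU : IsOpen U)
    (hd : DifferentiableOn ℂ f U) : DifferentiableOn ℂ (fderiv ℂ f) U := by
  intro c hc
  obtain ⟨R, hR, M, hsub, hM⟩ := exists_bound_near hU hd hc
  have e : 2 * (R / 2) = R := by ring
  exact (differentiableAt_fderiv_of_bounded (half_pos hR) (by rw [e]; exact hd.mono hsub)
    (by rwa [e])).differentiableWithinAt

end Holomorphic

/-! ### Locally biholomorphic maps, the radial field and its derivative. -/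

section LocallyBiholomorphic

variable {X : Type*} [NormedAddCommGroup X] [NormedSpace ℂ X]
  {f : X → X} {G : Set X}

/-- The vector field `Df(z)⁻¹ f(z)`. -/
noncomputable def radialField (f : X → X) (z : X) : X := (fderiv ℂ f z).inverse (f z)

/-- The bilinear map `Df(z)⁻¹ D²f(z)`. -/
noncomputable def preSchwarzian (f : X → X) (z : X) : X →L[ℂ] X →L[ℂ] X :=
  (ContinuousLinearMap.compL ℂ X X X (fderiv ℂ f z).inverse).comp (fderiv ℂ (fderiv ℂ f) z)

theorem preSchwarzian_apply (f : X → X) (z x y : X) :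
    preSchwarzian f z x y = (fderiv ℂ f z).inverse (fderiv ℂ (fderiv ℂ f) z x y) := rfl

namespace IsLocallyBiholomorphicOn

theorem differentiableOn (hf : IsLocallyBiholomorphicOn f G) : DifferentiableOn ℂ f G := by
  intro z hz
  obtain ⟨U, hzU, -, hU, hd, -⟩ := hf z hz
  exact (hd.differentiableAt (hU.1.mem_nhds hzU)).differentiableWithinAt

theorem isOpen (hf : IsLocallyBiholomorphicOn f G) : IsOpen G := by
  rw [isOpen_iff_mem_nhds]
  intro z hz
  obtain ⟨U, hzU, hUG, hU, -⟩ := hf z hz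
  exact mem_of_superset (hU.1.mem_nhds hzU) hUG

theorem image_mem_nhds (hf : IsLocallyBiholomorphicOn f G) {z : X} (hz : z ∈ G) :
    f '' G ∈ 𝓝 (f z) := by
  obtain ⟨U, hzU, hUG, -, -, hfU, -⟩ := hf z hz
  exact mem_of_superset (hfU.1.mem_nhds (mem_image_of_mem f hzU)) (image_mono hUG)

theorem isInvertible_fderiv (hf : IsLocallyBiholomorphicOn f G) {z : X} (hz : z ∈ G) :
    (fderiv ℂ f z).IsInvertible := by
  obtain ⟨U, hzU, hUG, hU, hd, hfU, g, hg, hinv⟩ := hf z hz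
  have hfz := (hd.differentiableAt (hU.1.mem_nhds hzU)).hasFDerivAt
  have hgz := (hg.differentiableAt (hfU.1.mem_nhds (mem_image_of_mem f hzU))).hasFDerivAt
  have hgf : g (f z) = z := hinv hzU
  refine ContinuousLinearMap.IsInvertible.of_inverse (g := fderiv ℂ g (f z)) ?_ ?_
  · have h1 : HasFDerivAt (f ∘ g) ((fderiv ℂ f z).comp (fderiv ℂ g (f z))) (f z) := by
      apply HasFDerivAt.comp
      · rwa [hgf]
      · exact hgz
    have h2 : HasFDerivAt (f ∘ g) (ContinuousLinearMap.id ℂ X) (f z) := by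
      refine (hasFDerivAt_id (f z)).congr_of_eventuallyEq ?_
      filter_upwards [hfU.1.mem_nhds (mem_image_of_mem f hzU)] with y hy
      obtain ⟨u, hu, rfl⟩ := hy
      simp [hinv hu]
    exact h1.unique h2
  · have h1 : HasFDerivAt (g ∘ f) ((fderiv ℂ g (f z)).comp (fderiv ℂ f z)) z := hgz.comp z hfz
    have h2 : HasFDerivAt (g ∘ f) (ContinuousLinearMap.id ℂ X) z := by
      refine (hasFDerivAt_id z).congr_of_eventuallyEq ?_
      filter_upwards [hU.1.mem_nhds hzU] with y hy
      simp [hinv hy]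
    exact h1.unique h2

theorem differentiableOn_inverse [CompleteSpace X] (hf : IsLocallyBiholomorphicOn f G) :
    DifferentiableOn ℂ (fun z => (fderiv ℂ f z).inverse) G := by
  intro z hz
  have h1 := (differentiableOn_fderiv hf.isOpen hf.differentiableOn).differentiableAt
    (hf.isOpen.mem_nhds hz)
  have h2 := ((hf.isInvertible_fderiv hz).contDiffAt_map_inverse (𝕜 := ℂ) (n := 1)).differentiableAt
    one_ne_zero
  exact (h2.comp z h1).differentiableWithinAt

theorem differentiableOn_radialField [CompleteSpace X] (hf : IsLocallyBiholomorphicOn f G) :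
    DifferentiableOn ℂ (radialField f) G :=
  hf.differentiableOn_inverse.clm_apply hf.differentiableOn

theorem differentiableOn_preSchwarzian [CompleteSpace X] (hf : IsLocallyBiholomorphicOn f G) (x y : X) :
    DifferentiableOn ℂ (fun z => preSchwarzian f z x y) G := by
  have h := differentiableOn_fderiv hf.isOpen (differentiableOn_fderiv hf.isOpen hf.differentiableOn)
  exact hf.differentiableOn_inverse.clm_apply
    ((h.clm_apply (differentiableOn_const x)).clm_apply (differentiableOn_const y))

theorem preSchwarzian_comm [CompleteSpace X] (hf : IsLocallyBiholomorphicOn f G) {z : X} (hz : z ∈ G) (x y : X) :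
    preSchwarzian f z x y = preSchwarzian f z y x := by
  rw [preSchwarzian_apply, preSchwarzian_apply]
  congr 1
  refine second_derivative_symmetric_of_eventually (f := f) (f' := fderiv ℂ f) (x := z) ?_ ?_ x y
  · filter_upwards [hf.isOpen.mem_nhds hz] with y hy
    exact (hf.differentiableOn.differentiableAt (hf.isOpen.mem_nhds hy)).hasFDerivAt
  · exact ((differentiableOn_fderiv hf.isOpen hf.differentiableOn).differentiableAt
      (hf.isOpen.mem_nhds hz)).hasFDerivAt

/-- Differentiate `Df(z) w(z) = f(z)` and apply `Df(z)⁻¹`. This is the link between the convexity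
condition on `T` and first-order information on `w`. -/
theorem fderiv_radialField [CompleteSpace X] (hf : IsLocallyBiholomorphicOn f G) {z : X} (hz : z ∈ G) (x : X) :
    fderiv ℂ (radialField f) z x = x - preSchwarzian f z (radialField f z) x := by
  have hw := (hf.differentiableOn_radialField.differentiableAt (hf.isOpen.mem_nhds hz)).hasFDerivAt
  have hf2 := ((differentiableOn_fderiv hf.isOpen hf.differentiableOn).differentiableAt
    (hf.isOpen.mem_nhds hz)).hasFDerivAt
  have hf1 := (hf.differentiableOn.differentiableAt (hf.isOpen.mem_nhds hz)).hasFDerivAt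
  have h1 := hf2.clm_apply hw
  have h2 : HasFDerivAt (fun y => fderiv ℂ f y (radialField f y)) (fderiv ℂ f z) z := by
    refine hf1.congr_of_eventuallyEq ?_
    filter_upwards [hf.isOpen.mem_nhds hz] with y hy
    exact (hf.isInvertible_fderiv hy).self_apply_inverse _
  have h3 := DFunLike.congr_fun (h1.unique h2) x
  simp only [add_apply, ContinuousLinearMap.comp_apply, ContinuousLinearMap.flip_apply] at h3
  have h4 := congrArg (fderiv ℂ f z).inverse h3
  rw [map_add, (hf.isInvertible_fderiv hz).inverse_apply_self,
    (hf.isInvertible_fderiv hz).inverse_apply_self] at h4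
  rw [hf.preSchwarzian_comm hz, preSchwarzian_apply]
  exact eq_sub_of_add_eq h4

end IsLocallyBiholomorphicOn

end LocallyBiholomorphic

/-! ### Bounds for the pre-Schwarzian and the radial field from convexity. -/

theorem norm_le_norm_two_mul_sub_of_re_le {H : ℂ → ℂ} {M R : ℝ} (hM : 0 < M) (hR : 1 < R)
    (hd : DifferentiableOn ℂ H (ball 0 R)) (hre : ∀ ζ ∈ ball (0 : ℂ) R, (H ζ).re ≤ M)
    (h0 : H 0 = 0) : ‖H 1‖ ≤ R⁻¹ * ‖2 * M - H 1‖ := by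
  have hne : ∀ ζ ∈ ball (0 : ℂ) R, (2 * M - H ζ : ℂ) ≠ 0 := by
    intro ζ hζ h
    have h1 := congrArg Complex.re h
    have h2 := hre ζ hζ
    simp at h1
    linarith
  have hle : ∀ ζ ∈ ball (0 : ℂ) R, ‖H ζ‖ ≤ ‖(2 * M - H ζ : ℂ)‖ := by
    intro ζ hζ
    have h2 := hre ζ hζ
    rw [← sq_le_sq₀ (norm_nonneg _) (norm_nonneg _), Complex.sq_norm, Complex.sq_norm,
      Complex.normSq_apply, Complex.normSq_apply]
    simp
    nlinarith
  have h1 : (1 : ℂ) ∈ ball (0 : ℂ) R := by simpa using hR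
  -- `H / (2M - H)` carries the half-plane `Re ≤ M` into the unit disc and fixes `0`, so Schwarz's
  -- lemma applies.
  have key := Complex.dist_le_div_mul_dist_of_mapsTo_ball (f := fun ζ => H ζ / (2 * M - H ζ))
    (R₂ := 1) (hd.div ((differentiableOn_const _).sub hd) hne) (fun ζ hζ => by
      simp only [h0, zero_div, mem_closedBall, dist_zero_right, norm_div]
      exact div_le_one_of_le₀ (hle ζ hζ) (norm_nonneg _)) h1
  simp only [h0, zero_div, dist_zero_right, norm_div, norm_one, mul_one, one_div] at key
  rwa [div_le_iff₀ (norm_pos_iff.2 (hne 1 h1))] at key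

section Inner

variable {X : Type*} [NormedAddCommGroup X] [InnerProductSpace ℂ X]

theorem exists_norm_one_re_inner_smul_eq_zero (z x : X) :
    ∃ e : ℂ, ‖e‖ = 1 ∧ (inner ℂ z (e • x)).re = 0 := by
  rcases eq_or_ne (inner ℂ z x) 0 with h | h
  · exact ⟨1, by simp, by simp [h]⟩
  · have hpos : (‖inner ℂ z x‖ : ℂ) ≠ 0 := by simpa using h
    refine ⟨Complex.I * (starRingEnd ℂ (inner ℂ z x)) / ‖inner ℂ z x‖, ?_, ?_⟩
    · rw [norm_div, norm_mul, Complex.norm_I, one_mul, RCLike.norm_conj, Complex.norm_real,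
        norm_norm, div_self (norm_ne_zero_iff.2 h)]
    · rw [inner_smul_right]
      have : Complex.I * (starRingEnd ℂ (inner ℂ z x)) / ‖inner ℂ z x‖ * inner ℂ z x =
          Complex.I * ‖inner ℂ z x‖ := by
        field_simp
        rw [Complex.conj_mul']
      rw [this]; simp

/-- A bound for the numerical values `⟨h(z), z⟩` of a holomorphic map controls the map itself. -/
theorem norm_inner_le_of_norm_inner_self_le {h : X → X} {ρ K : ℝ}
    (hd : DifferentiableOn ℂ h (ball 0 ρ)) (hK : ∀ z ∈ ball (0 : X) ρ, ‖inner ℂ z (h z)‖ ≤ K)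
    {z u : X} (hzu : ‖z‖ + ‖u‖ < ρ) : ‖inner ℂ u (h z)‖ ≤ K := by
  have hmem : ∀ l : ℂ, ‖l‖ ≤ 1 → z + l • u ∈ ball (0 : X) ρ := by
    intro l hl
    rw [mem_ball_zero_iff]
    have h1 := norm_add_le z (l • u)
    rw [norm_smul] at h1
    nlinarith [norm_nonneg u]
  have hhd : DifferentiableOn ℂ (fun l : ℂ => h (z + l • u)) (closedBall 0 1) :=
    hd.comp (by fun_prop) fun l hl => hmem l (by simpa using hl)
  -- On `|l| = 1` this function equals `l ⟨h(z + lu), z + lu⟩`, because `l l̄ = 1`; at `l = 0` it is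
  -- `⟨h(z), u⟩`. The maximum principle compares the two.
  have hφ : DifferentiableOn ℂ (fun l : ℂ => l * inner ℂ z (h (z + l • u)) +
      inner ℂ u (h (z + l • u))) (closedBall 0 1) := by
    refine (differentiableOn_id.mul ?_).add ?_
    · exact (innerSL ℂ z).differentiable.comp_differentiableOn hhd
    · exact (innerSL ℂ u).differentiable.comp_differentiableOn hhd
  have hcl : closure (ball (0 : ℂ) 1) = closedBall 0 1 := closure_ball _ one_ne_zero
  have := Complex.norm_le_of_forall_mem_frontier_norm_le (C := K) isBounded_ball
    (DifferentiableOn.diffContOnCl (by rwa [hcl]) : DiffContOnCl ℂ _ (ball (0 : ℂ) 1)) ?_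
    (subset_closure (mem_ball_self one_pos))
  · simpa using this
  · intro l hl
    rw [frontier_ball _ one_ne_zero, mem_sphere_zero_iff_norm] at hl
    refine le_trans (le_of_eq ?_) (hK _ (hmem l hl.le))
    have hl' : l * (starRingEnd ℂ) l = 1 := by rw [Complex.mul_conj']; simp [hl]
    have : l * inner ℂ z (h (z + l • u)) + inner ℂ u (h (z + l • u)) =
        l * inner ℂ (z + l • u) (h (z + l • u)) := by
      rw [inner_add_left, inner_smul_left, mul_add, ← mul_assoc, hl', one_mul]
    rw [this, norm_mul, hl, one_mul]

theorem norm_mul_le_of_norm_inner_self_le {h : X → X} {ρ K : ℝ}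
    (hd : DifferentiableOn ℂ h (ball 0 ρ)) (hK : ∀ z ∈ ball (0 : X) ρ, ‖inner ℂ z (h z)‖ ≤ K)
    {z : X} {t : ℝ} (ht : 0 < t) (hzt : ‖z‖ + t < ρ) : t * ‖h z‖ ≤ K := by
  rcases eq_or_ne (h z) 0 with h0 | h0
  · rw [h0, norm_zero, mul_zero]
    exact (norm_nonneg _).trans (hK z (by rw [mem_ball_zero_iff]; linarith))
  have hpos := norm_pos_iff.2 h0
  have := norm_inner_le_of_norm_inner_self_le hd hK (z := z) (u := ((t / ‖h z‖ : ℝ) : ℂ) • h z)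
    (by rw [norm_smul, Complex.norm_real, Real.norm_of_nonneg (by positivity),
      div_mul_cancel₀ _ hpos.ne']; exact hzt)
  rw [inner_smul_left, inner_self_eq_norm_sq_to_K, norm_mul, RCLike.norm_conj, Complex.norm_real,
    Real.norm_of_nonneg (by positivity)] at this
  simp only [Complex.coe_algebraMap, norm_pow, Complex.norm_real, norm_norm] at this
  convert! this using 1
  field_simp

end Inner

/-- Polarization at unit vectors; the parallelogram law keeps the constant `C` unchanged. -/
theorem norm_bilin_le_of_norm_diag_le {E F : Type*} [NormedAddCommGroup E]
    [InnerProductSpace ℂ E] [NormedAddCommGroup F] [NormedSpace ℂ F] (T : E →L[ℂ] E →L[ℂ] F)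
    (hsymm : ∀ x y, T x y = T y x) {C : ℝ} (hT : ∀ x, ‖T x x‖ ≤ C * ‖x‖ ^ 2) (x y : E) :
    ‖T x y‖ ≤ C * ‖x‖ * ‖y‖ := by
  have hpol : ∀ x y, ‖T x y‖ ≤ C * (‖x‖ ^ 2 + ‖y‖ ^ 2) / 2 := by
    intro x y
    have h1 : (4 : ℂ) • T x y = T (x + y) (x + y) - T (x - y) (x - y) := by
      simp only [map_add, map_sub, add_apply, sub_apply, hsymm y x]
      module
    have h2 : 4 * ‖T x y‖ = ‖T (x + y) (x + y) - T (x - y) (x - y)‖ := by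
      rw [← h1, norm_smul]; simp
    have h3 := parallelogram_law_with_norm ℂ x y
    have h4 : C * ‖x + y‖ ^ 2 + C * ‖x - y‖ ^ 2 = C * (2 * (‖x‖ ^ 2 + ‖y‖ ^ 2)) := by
      rw [← mul_add, h3]
    linarith [norm_sub_le (T (x + y) (x + y)) (T (x - y) (x - y)), hT (x + y), hT (x - y)]
  rcases eq_or_ne x 0 with rfl | hx
  · simp
  rcases eq_or_ne y 0 with rfl | hy
  · simp
  have hx' := norm_pos_iff.2 hx
  have hy' := norm_pos_iff.2 hy
  have hu : ∀ x : E, x ≠ 0 → ‖((‖x‖⁻¹ : ℝ) : ℂ) • x‖ = 1 := by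
    intro x hx
    rw [norm_smul, Complex.norm_real, norm_inv, norm_norm, inv_mul_cancel₀ (norm_ne_zero_iff.2 hx)]
  have := hpol (((‖x‖⁻¹ : ℝ) : ℂ) • x) (((‖y‖⁻¹ : ℝ) : ℂ) • y)
  rw [hu x hx, hu y hy] at this
  simp only [map_smul, smul_apply, norm_smul, Complex.norm_real, norm_inv,
    norm_norm] at this
  have e : ‖y‖⁻¹ * (‖x‖⁻¹ * ‖T x y‖) = ‖T x y‖ / (‖x‖ * ‖y‖) := by field_simp
  simp only [e] at this
  rw [div_le_iff₀ (by positivity)] at this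
  linarith

namespace IsConvexOfOrder

variable {X : Type*} [NormedAddCommGroup X] [InnerProductSpace ℂ X] [CompleteSpace X]
  {f : X → X} {α : ℝ}

/-- Multiplying `z` and `x` by the same `ζ` preserves tangency. Convexity at `ζz` in the direction
`ζx`, divided by `|ζ|²`, puts `ζ ⟨T(ζz)(x, x), z⟩` in a half-plane for all `|ζ| < 1/‖z‖`; Schwarz's
lemma at `ζ = 1` gives the factor `‖z‖`. -/
theorem norm_inner_preSchwarzian_le_norm_two_mul_sub (hf : IsConvexOfOrder α f) (hα : α < 1)
    {z : X} (hz : z ∈ ball (0 : X) 1) {x : X} (hx : (inner ℂ z x).re = 0) :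
    ‖inner ℂ z (preSchwarzian f z x x)‖ ≤
      ‖z‖ * ‖2 * ((1 - α) * ‖x‖ ^ 2 : ℝ) - inner ℂ z (preSchwarzian f z x x)‖ := by
  rcases eq_or_ne z 0 with rfl | hz0
  · simp
  rcases eq_or_ne x 0 with rfl | hx0
  · simp
  have hzpos := norm_pos_iff.2 hz0
  have hxpos := norm_pos_iff.2 hx0
  rw [mem_ball_zero_iff] at hz
  have hmem : ∀ ζ ∈ ball (0 : ℂ) ‖z‖⁻¹, ζ • z ∈ ball (0 : X) 1 := by
    intro ζ hζ
    rw [mem_ball_zero_iff] at hζ ⊢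
    rw [norm_smul]
    calc ‖ζ‖ * ‖z‖ < ‖z‖⁻¹ * ‖z‖ := by gcongr
      _ = 1 := inv_mul_cancel₀ hzpos.ne'
  have key := norm_le_norm_two_mul_sub_of_re_le
    (H := fun ζ => ζ * inner ℂ z (preSchwarzian f (ζ • z) x x)) (M := (1 - α) * ‖x‖ ^ 2)
    (R := ‖z‖⁻¹) (mul_pos (by linarith) (by positivity)) ((one_lt_inv₀ hzpos).2 hz) ?_ ?_ (by simp)
  · simpa using key
  · refine differentiableOn_id.mul ((innerSL ℂ z).differentiable.comp_differentiableOn ?_)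
    exact (hf.1.differentiableOn_preSchwarzian x x).comp (by fun_prop) hmem
  · intro ζ hζ
    rcases eq_or_ne ζ 0 with rfl | hζ0
    · have : 0 < (1 - α) * ‖x‖ ^ 2 := mul_pos (by linarith) (by positivity)
      simpa using this.le
    have hζp := norm_pos_iff.2 hζ0
    have h1 := hf.2 (ζ • z) (hmem ζ hζ) (smul_ne_zero hζ0 hz0) (ζ • x) (smul_ne_zero hζ0 hx0) (by
      rw [inner_smul_left, inner_smul_right, ← mul_assoc, Complex.conj_mul']
      norm_cast
      rw [Complex.re_ofReal_mul, hx, mul_zero])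
    rw [← preSchwarzian_apply] at h1
    simp only [map_smul, smul_apply, inner_smul_left, inner_smul_right, norm_smul] at h1
    have h2 : ζ * (ζ * ((starRingEnd ℂ) ζ * inner ℂ z (preSchwarzian f (ζ • z) x x))) =
        ((‖ζ‖ ^ 2 : ℝ) : ℂ) * (ζ * inner ℂ z (preSchwarzian f (ζ • z) x x)) := by
      push_cast
      linear_combination (ζ * inner ℂ z (preSchwarzian f (ζ • z) x x)) * Complex.conj_mul' ζ
    rw [h2, Complex.re_ofReal_mul] at h1
    have h3 : 0 < ‖ζ‖ ^ 2 := by positivity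
    refine le_of_mul_le_mul_left ?_ h3
    nlinarith

/-- The disc `|h| ≤ ρ |2M - h|` has largest real part `2Mρ / (1 + ρ)`. The gain over `M = (1 -
α)‖x‖²` is a factor uniform on the ball of radius `ρ`; it supplies the strict inequality `b < 1 - α`
used below. -/
theorem re_inner_preSchwarzian_le (hf : IsConvexOfOrder α f) (hα : α < 1) {ρ : ℝ} (hρ : ρ < 1)
    {z : X} (hz : ‖z‖ ≤ ρ) {x : X} (hx : (inner ℂ z x).re = 0) :
    (inner ℂ z (preSchwarzian f z x x)).re ≤ (1 - α) * (2 * ρ / (1 + ρ)) * ‖x‖ ^ 2 := by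
  have hρ0 : 0 ≤ ρ := (norm_nonneg z).trans hz
  have h1 := hf.norm_inner_preSchwarzian_le_norm_two_mul_sub hα
    (mem_ball_zero_iff.2 (hz.trans_lt hρ)) hx
  set h := inner ℂ z (preSchwarzian f z x x)
  set M := (1 - α) * ‖x‖ ^ 2 with hMdef
  have hM : 0 ≤ M := mul_nonneg (by linarith) (by positivity)
  have h2 : ‖h‖ ≤ ρ * ‖(2 * M - h : ℂ)‖ := h1.trans (by gcongr)
  have h3 : ‖h‖ ^ 2 ≤ ρ ^ 2 * ‖(2 * M - h : ℂ)‖ ^ 2 := by rw [← mul_pow]; gcongr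
  rw [Complex.sq_norm, Complex.sq_norm, Complex.normSq_apply, Complex.normSq_apply] at h3
  simp only [Complex.sub_re, Complex.mul_re, Complex.re_ofNat, Complex.ofReal_re,
    Complex.im_ofNat, Complex.ofReal_im, Complex.sub_im, Complex.mul_im] at h3
  have h4 : h.re * (1 + ρ) ≤ 2 * M * ρ := by
    by_contra! hcon
    have h5 : 0 < h.re := by
      by_contra! h6
      nlinarith [mul_nonneg hM hρ0]
    have h7 : h.re * h.re ≤ ρ ^ 2 * ((2 * M - h.re) * (2 * M - h.re)) := by
      have : ρ ^ 2 ≤ 1 := by nlinarith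
      nlinarith [mul_nonneg (by linarith : 0 ≤ 1 - ρ ^ 2) (mul_self_nonneg h.im)]
    rcases le_or_gt (ρ * |2 * M - h.re|) 0 with h8 | h8
    · have h9 : ρ * |2 * M - h.re| = 0 := le_antisymm h8 (by positivity)
      have h10 : (ρ * |2 * M - h.re|) ^ 2 = ρ ^ 2 * ((2 * M - h.re) * (2 * M - h.re)) := by
        rw [mul_pow, sq_abs]; ring
      rw [h9] at h10
      nlinarith
    · have h10 : h.re ≤ ρ * |2 * M - h.re| := by
        refine le_of_sq_le_sq ?_ h8.le
        rw [mul_pow, sq_abs]; linarith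
      rcases abs_cases (2 * M - h.re) with ⟨h11, _⟩ | ⟨h11, _⟩ <;> rw [h11] at h10 <;> nlinarith
  have e : (1 - α) * (2 * ρ / (1 + ρ)) * ‖x‖ ^ 2 = 2 * M * ρ / (1 + ρ) := by
    rw [hMdef]; ring
  rw [e, le_div_iff₀ (by linarith)]
  exact h4

/-- A unimodular factor makes any `x` tangential and does not change the modulus of the quadratic
form. -/
theorem norm_inner_preSchwarzian_le (hf : IsConvexOfOrder α f) (hα : α < 1) {z : X}
    (hz : z ∈ ball (0 : X) 1) (x : X) :
    ‖inner ℂ z (preSchwarzian f z x x)‖ ≤ 2 * (1 - α) / (1 - ‖z‖) * ‖x‖ ^ 2 := by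
  obtain ⟨e, he, hex⟩ := exists_norm_one_re_inner_smul_eq_zero z x
  have h1 := hf.norm_inner_preSchwarzian_le_norm_two_mul_sub hα hz hex
  simp only [map_smul, smul_apply, inner_smul_right, norm_smul, he, one_mul] at h1
  rw [mem_ball_zero_iff] at hz
  set M := (1 - α) * ‖x‖ ^ 2 with hMdef
  have hM : 0 ≤ M := mul_nonneg (by linarith) (by positivity)
  have h2 := norm_sub_le (2 * M : ℂ) (e * (e * inner ℂ z (preSchwarzian f z x x)))
  simp only [norm_mul, he, one_mul, Complex.norm_real, Complex.norm_ofNat,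
    Real.norm_of_nonneg hM] at h1 h2
  have e : 2 * (1 - α) / (1 - ‖z‖) * ‖x‖ ^ 2 = 2 * M / (1 - ‖z‖) := by rw [hMdef]; ring
  rw [e, le_div_iff₀ (by linarith)]
  nlinarith [norm_nonneg z, mul_le_mul_of_nonneg_left h2 (norm_nonneg z)]

/-- The values `⟨T(x, x), z⟩` on a slightly larger ball control `T(x, x)` by the maximum principle,
and polarization then controls `T`. -/
theorem exists_norm_preSchwarzian_le (hf : IsConvexOfOrder α f) (hα : α < 1) {ρ : ℝ}
    (hρ : ρ < 1) : ∃ C, 0 ≤ C ∧ ∀ z : X, ‖z‖ ≤ ρ → ∀ x y,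
      ‖preSchwarzian f z x y‖ ≤ C * ‖x‖ * ‖y‖ := by
  have hρ' : 0 < 1 - ρ := by linarith
  refine ⟨2 * (1 - α) / ((1 - ρ) / 2) / ((1 - ρ) / 4),
    div_nonneg (div_nonneg (by linarith) (by linarith)) (by linarith), fun z hz => ?_⟩
  have hzb : z ∈ ball (0 : X) 1 := mem_ball_zero_iff.2 (hz.trans_lt hρ)
  refine norm_bilin_le_of_norm_diag_le _ (hf.1.preSchwarzian_comm hzb) fun x => ?_
  have hsub : ball (0 : X) ((1 + ρ) / 2) ⊆ ball 0 1 := ball_subset_ball (by linarith)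
  have := norm_mul_le_of_norm_inner_self_le (h := fun z => preSchwarzian f z x x)
    (ρ := (1 + ρ) / 2) (K := 2 * (1 - α) / ((1 - ρ) / 2) * ‖x‖ ^ 2)
    ((hf.1.differentiableOn_preSchwarzian x x).mono hsub) (fun y hy => by
      refine (hf.norm_inner_preSchwarzian_le hα (hsub hy) x).trans ?_
      rw [mem_ball_zero_iff] at hy
      have : 0 ≤ 2 * (1 - α) := by linarith
      gcongr
      linarith) (z := z) (t := (1 - ρ) / 4) (by linarith) (by linarith)
  rw [div_mul_eq_mul_div, le_div_iff₀ (by linarith)]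
  linarith

end IsConvexOfOrder

theorem radialField_zero {X : Type*} [NormedAddCommGroup X] [NormedSpace ℂ X] {f : X → X}
    (h0 : f 0 = 0) : radialField f 0 = 0 := by
  simp [radialField, h0]

/-- Grönwall along the ray `t ↦ tz`: there the derivative of `w` has norm at most `1 + C‖w‖`, and
`w` starts from `0`. -/
theorem IsConvexOfOrder.exists_norm_radialField_le {X : Type*} [NormedAddCommGroup X]
    [InnerProductSpace ℂ X] [CompleteSpace X] {f : X → X} {α : ℝ} (hf : IsConvexOfOrder α f)
    (hα : α < 1) (h0 : f 0 = 0) {ρ : ℝ} (hρ : ρ < 1) :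
    ∃ K, 0 ≤ K ∧ ∀ z : X, ‖z‖ ≤ ρ → ‖radialField f z‖ ≤ K := by
  obtain ⟨C, hC0, hC⟩ := hf.exists_norm_preSchwarzian_le hα hρ
  refine ⟨max 0 (gronwallBound 0 C 1 1), le_max_left _ _, fun z hz => le_max_of_le_right ?_⟩
  have hmem : ∀ t ∈ Icc (0 : ℝ) 1, ‖(t : ℂ) • z‖ ≤ ρ := by
    intro t ht
    rw [norm_smul, Complex.norm_real, Real.norm_of_nonneg ht.1]
    nlinarith [ht.1, ht.2, norm_nonneg z]
  have hder : ∀ t ∈ Icc (0 : ℝ) 1, HasDerivAt (fun t : ℝ => radialField f ((t : ℂ) • z))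
      (fderiv ℂ (radialField f) ((t : ℂ) • z) z) t := by
    intro t ht
    have h1 : DifferentiableAt ℂ (radialField f) (0 + (t : ℂ) • z) := by
      rw [zero_add]
      exact hf.1.differentiableOn_radialField.differentiableAt
        (isOpen_ball.mem_nhds (mem_ball_zero_iff.2 ((hmem t ht).trans_lt hρ)))
    simpa [Function.comp_def] using (hasDerivAt_line h1).scomp t Complex.ofRealCLM.hasDerivAt
  have := norm_le_gronwallBound_of_norm_deriv_right_le
    (f := fun t : ℝ => radialField f ((t : ℂ) • z)) (a := 0) (b := 1) (δ := 0) (K := C) (ε := 1)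
    (fun t ht => (hder t ht).continuousAt.continuousWithinAt)
    (fun t ht => (hder t (Ico_subset_Icc_self ht)).hasDerivWithinAt)
    (by simp [radialField_zero h0]) (fun t ht => ?_) 1 (by simp)
  · simpa using this
  · have ht' := Ico_subset_Icc_self ht
    rw [hf.1.fderiv_radialField (mem_ball_zero_iff.2 ((hmem t ht').trans_lt hρ))]
    have h1 := hC _ (hmem t ht') (radialField f ((t : ℂ) • z)) z
    have h2 := norm_sub_le z (preSchwarzian f ((t : ℂ) • z) (radialField f ((t : ℂ) • z)) z)
    have h3 : C * ‖radialField f ((t : ℂ) • z)‖ * ‖z‖ ≤ C * ‖radialField f ((t : ℂ) • z)‖ * 1 := by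
      gcongr; linarith
    linarith

/-! ### The algebra excluding a boundary contact. -/

open ComplexConjugate in
-- Every vector `i(|p| z + l v)`, `l ∈ ℂ`, is tangential at `z`. Averaging the hypothesis over two
-- well-chosen `l` isolates the two terms `p̄ ⟨T(w, z), z⟩` and `⟨T(w, v), z⟩` with `w = pz + v`,
-- the second with a free unimodular factor.
theorem norm_inner_bilin_le {X : Type*} [NormedAddCommGroup X] [InnerProductSpace ℂ X]
    (T : X →L[ℂ] X →L[ℂ] X) (hsymm : ∀ x y, T x y = T y x) {z v : X} {p : ℂ} {b : ℝ}
    (hzv : inner ℂ z v = 0)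
    (hT : ∀ x, (inner ℂ z x).re = 0 → (inner ℂ z (T x x)).re ≤ b * ‖x‖ ^ 2) :
    ‖inner ℂ z (T (p • z + v) v)‖ ≤
      (conj p * inner ℂ z (T (p • z + v) z)).re + b * (‖p‖ ^ 2 * ‖z‖ ^ 2 + ‖v‖ ^ 2) := by
  obtain ⟨η, hη, hηp⟩ : ∃ η : ℂ, ‖η‖ = 1 ∧ η * p = ‖p‖ := by
    rcases eq_or_ne p 0 with rfl | hp
    · exact ⟨1, by simp, by simp⟩
    · have : (‖p‖ : ℂ) ≠ 0 := by simpa using hp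
      refine ⟨conj p / ‖p‖, by simp [hp], ?_⟩
      field_simp
      exact Complex.conj_mul' p
  have hη' : conj η * η = 1 := by rw [Complex.conj_mul']; simp [hη]
  set μ := ‖p‖ with hμ
  set Bzz := inner ℂ z (T z z) with hBzz
  set Bzv := inner ℂ z (T z v) with hBzv
  set Bvv := inner ℂ z (T v v) with hBvv
  have hvz : inner ℂ z (T v z) = Bzv := by rw [hsymm]
  have hwz : inner ℂ z (T (p • z + v) z) = p * Bzz + Bzv := by
    simp only [map_add, map_smul, add_apply, smul_apply, inner_add_right, inner_smul_right, hvz, hBzz]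
  have hwv : inner ℂ z (T (p • z + v) v) = p * Bzv + Bvv := by
    simp only [map_add, map_smul, add_apply, smul_apply, inner_add_right, inner_smul_right,
      hBzv, hBvv]
  have hη2 : η ^ 2 * p = conj p := by
    have h1 : conj η * conj p = μ := by
      have := congrArg conj hηp
      simpa using this
    linear_combination η * hηp - η * h1 + conj p * hη'
  have htest : ∀ l : ℂ, -(μ ^ 2 * Bzz + 2 * μ * l * Bzv + l ^ 2 * Bvv).re ≤
      b * (μ ^ 2 * ‖z‖ ^ 2 + ‖l‖ ^ 2 * ‖v‖ ^ 2) := by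
    intro l
    have h1 := hT (Complex.I • ((μ : ℂ) • z + l • v)) (by
      rw [inner_smul_right, inner_add_right, inner_smul_right, inner_smul_right, hzv,
        inner_self_eq_norm_sq_to_K]
      simp [← Complex.ofReal_pow, ← Complex.ofReal_mul])
    have h2 : inner ℂ z (T (Complex.I • ((μ : ℂ) • z + l • v)) (Complex.I • ((μ : ℂ) • z + l • v)))
        = -(μ ^ 2 * Bzz + 2 * μ * l * Bzv + l ^ 2 * Bvv) := by
      simp only [map_smul, map_add, smul_apply, add_apply, inner_smul_right, inner_add_right, hvz]
      linear_combination (μ ^ 2 * Bzz + 2 * μ * l * Bzv + l ^ 2 * Bvv) * Complex.I_mul_I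
    have h3 : ‖Complex.I • ((μ : ℂ) • z + l • v)‖ ^ 2 = μ ^ 2 * ‖z‖ ^ 2 + ‖l‖ ^ 2 * ‖v‖ ^ 2 := by
      rw [norm_smul, Complex.norm_I, one_mul, @norm_add_sq ℂ]
      rw [inner_smul_left, inner_smul_right, hzv]
      simp [norm_smul, mul_pow, hμ]
    rw [h2, h3] at h1
    simpa using h1
  obtain ⟨U, hU, hUB⟩ : ∃ U : ℂ, ‖U‖ = 1 ∧ η ^ 2 * (U * (p * Bzv + Bvv)) = -‖p * Bzv + Bvv‖ := by
    rcases eq_or_ne (p * Bzv + Bvv) 0 with h | h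
    · exact ⟨1, by simp, by simp [h]⟩
    · have hpos : (‖p * Bzv + Bvv‖ : ℂ) ≠ 0 := by simpa using h
      refine ⟨-(conj η) ^ 2 * conj (p * Bzv + Bvv) / ‖p * Bzv + Bvv‖, ?_, ?_⟩
      · rw [norm_div, norm_mul, RCLike.norm_conj, norm_neg, norm_pow, RCLike.norm_conj, hη]
        rw [Complex.norm_real, norm_norm, one_pow, one_mul, div_self (norm_ne_zero_iff.2 h)]
      · have h5 := Complex.conj_mul' (p * Bzv + Bvv)
        rw [div_mul_eq_mul_div, mul_div_assoc', div_eq_iff hpos]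
        linear_combination (-(conj η * η + 1) * conj (p * Bzv + Bvv) * (p * Bzv + Bvv)) * hη' - h5
  have hUU : U.re ^ 2 + U.im ^ 2 = 1 := by
    have := Complex.sq_norm U
    rw [hU, Complex.normSq_apply] at this
    nlinarith
  -- The two values of `l` have sum `η(1 + U)`, sum of squares `2η²U`, and sum of squared moduli
  -- `2`. The factor `U` was chosen to turn the second term into minus its modulus.
  have ha := htest (η * ((1 + Complex.I) + U * (1 - Complex.I)) / 2)
  have hb := htest (η * ((1 - Complex.I) + U * (1 + Complex.I)) / 2)
  have hna : ‖η * ((1 + Complex.I) + U * (1 - Complex.I)) / 2‖ ^ 2 = 1 + U.im := by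
    rw [norm_div, norm_mul, hη, one_mul, div_pow, Complex.sq_norm, Complex.normSq_apply]
    simp
    nlinarith
  have hnb : ‖η * ((1 - Complex.I) + U * (1 + Complex.I)) / 2‖ ^ 2 = 1 - U.im := by
    rw [norm_div, norm_mul, hη, one_mul, div_pow, Complex.sq_norm, Complex.normSq_apply]
    simp
    nlinarith
  rw [hna] at ha
  rw [hnb] at hb
  have hsum : (μ ^ 2 * Bzz + 2 * μ * (η * ((1 + Complex.I) + U * (1 - Complex.I)) / 2) * Bzv +
      (η * ((1 + Complex.I) + U * (1 - Complex.I)) / 2) ^ 2 * Bvv) +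
      (μ ^ 2 * Bzz + 2 * μ * (η * ((1 - Complex.I) + U * (1 + Complex.I)) / 2) * Bzv +
      (η * ((1 - Complex.I) + U * (1 + Complex.I)) / 2) ^ 2 * Bvv) =
      2 * (conj p * (p * Bzz + Bzv) + η ^ 2 * (U * (p * Bzv + Bvv))) := by
    rw [← hη2, ← hηp]
    linear_combination (η ^ 2 * Bvv * (1 - U) ^ 2 / 2) * Complex.I_mul_I
  have hre := congrArg Complex.re hsum
  rw [hUB] at hre
  simp only [Complex.add_re] at hre
  rw [hwz, hwv]
  have h6 : (2 * (conj p * (p * Bzz + Bzv) + -(‖p * Bzv + Bvv‖ : ℂ))).re =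
    2 * ((conj p * (p * Bzz + Bzv)).re - ‖p * Bzv + Bvv‖) := by
    rw [show (2 : ℂ) = ((2 : ℝ) : ℂ) by simp, Complex.re_ofReal_mul]
    simp [sub_eq_add_neg]
  rw [h6] at hre
  simp only [Complex.add_re] at ha hb
  linarith

/-- The place where `β` is determined. As `β² - (2β - 1) = (1 - β)²`, the bounds on `q` and `m` give
`mβ ≥ (1 - β) / (2β)`, which is `β - α` by the quadratic equation. Then `h` reads `(1 - α - b) q +
(1 - b) σ ≤ 0`. -/
theorem eq_zero_of_convexity_inequalities {α β b q m σ : ℝ} (hα : 0 ≤ α) (hβ : 1 / 2 ≤ β)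
    (hβ1 : β < 1) (hαβ : 2 * β ^ 2 - (2 * α - 1) * β - 1 = 0) (hb : b < 1 - α) (hq : 0 ≤ q)
    (hσ : 0 ≤ σ) (hβq : β ^ 2 * q ≤ 1) (hm : 1 - (2 * β - 1) * q ≤ 2 * (1 - β) * m)
    (h : σ ≤ β * q - m * β * q - q + b * (q + σ)) : q = 0 ∧ σ = 0 := by
  have hmβ : β - α ≤ m * β := by
    have e0 : β ^ 2 * (1 - (2 * β - 1) * q) ≤ β ^ 2 * (2 * (1 - β) * m) :=
      mul_le_mul_of_nonneg_left hm (sq_nonneg β)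
    have e1 : (2 * β - 1) * (β ^ 2 * q) ≤ (2 * β - 1) * 1 :=
      mul_le_mul_of_nonneg_left hβq (by linarith)
    have e2 : (1 - β) * (1 - β) ≤ (1 - β) * (2 * β ^ 2 * m) := by linarith
    have e3 : 1 - β ≤ 2 * β ^ 2 * m := le_of_mul_le_mul_left e2 (by linarith)
    refine le_of_mul_le_mul_left (a := 2 * β) ?_ (by linarith)
    linarith
  have h1 : (β - α) * q ≤ m * β * q := mul_le_mul_of_nonneg_right hmβ hq
  have h2 : 0 ≤ (1 - α - b) * q := mul_nonneg (by linarith) hq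
  have h3 : 0 ≤ (1 - α - b) * σ := mul_nonneg (by linarith) hσ
  have h4 : 0 ≤ α * σ := mul_nonneg hα hσ
  have h5 : (1 - α - b) * q = 0 := by linarith
  have h6 : (1 - α - b) * σ = 0 := by linarith
  have h7 : 1 - α - b ≠ 0 := by linarith
  exact ⟨(mul_eq_zero.1 h5).resolve_left h7, (mul_eq_zero.1 h6).resolve_left h7⟩

open ComplexConjugate in
-- With `N = 1 - 2βp̄`, the derivative of `β|p|² - Re p` in the direction `q` is `-Re(Nq)`, and `|N|
-- = 1` on the circle. Stationarity along `iz`, `v`, `iv` is `h2`, `h4`, `h4'`; `h3` is the radial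
-- inequality, `h5` is convexity, and `h6` comes from the boundedness of `T`.
theorem jack_algebra {α β b C : ℝ} (hα : 0 ≤ α) (hβ : 1 / 2 ≤ β) (hβ1 : β < 1)
    (hαβ : 2 * β ^ 2 - (2 * α - 1) * β - 1 = 0) (hb : b < 1 - α) {p D A : ℂ} {σ : ℝ}
    (hσ : 0 ≤ σ) (h1 : β * ‖p‖ ^ 2 = p.re) (h2 : ((1 - 2 * β * conj p) * D).im = 0)
    (h3 : 2 * (1 - β) * ((1 - 2 * β * conj p) * D).re ≤ -‖1 - (2 * β - 1) * p‖ ^ 2)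
    (h4 : ((1 - 2 * β * conj p) * (A + σ)).re = 0) (h4' : ((1 - 2 * β * conj p) * (A - σ)).im = 0)
    (h5 : ‖A‖ ≤ (conj p * (1 - D - p)).re + b * (‖p‖ ^ 2 + σ))
    (h6 : ‖1 - D - p‖ ^ 2 ≤ C * (‖p‖ ^ 2 + σ)) : False := by
  have hp2 : ‖p‖ ^ 2 = p.re ^ 2 + p.im ^ 2 := by
    rw [Complex.sq_norm, Complex.normSq_apply]; ring
  have hN : ‖1 - 2 * β * conj p‖ = 1 := by
    rw [← sq_eq_sq₀ (norm_nonneg _) zero_le_one, Complex.sq_norm, Complex.normSq_apply]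
    simp
    rw [hp2] at h1
    nlinarith
  have hA : ‖A‖ = σ := by
    have e : (1 - 2 * β * conj p) * A = -(conj (1 - 2 * β * conj p) * σ) := by
      apply Complex.ext
      · simp at h4 ⊢; linarith
      · simp at h4' ⊢; linarith
    have := congrArg norm e
    rw [norm_mul, hN, norm_neg, norm_mul, RCLike.norm_conj, hN, one_mul, one_mul,
      Complex.norm_real, Real.norm_of_nonneg hσ] at this
    exact this
  set m := -((1 - 2 * β * conj p) * D).re with hm
  have hND : (1 - 2 * β * conj p) * D = ((-m : ℝ) : ℂ) := by
    apply Complex.ext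
    · simp [hm]
    · rw [h2]; simp
  -- `N D` is the real number `-m` and `N` is unimodular, so `D = -m N̄`.
  have hD : D = -m * (1 - 2 * β * p) := by
    have h7 : conj (1 - 2 * β * conj p) * (1 - 2 * β * conj p) = 1 := by
      rw [Complex.conj_mul', hN]; simp
    have h8 : conj (1 - 2 * β * conj p) = 1 - 2 * β * p := by
      apply Complex.ext <;> simp
    rw [h8] at h7
    have : D = (1 - 2 * β * p) * ((1 - 2 * β * conj p) * D) := by
      rw [← mul_assoc, h7, one_mul]
    rw [this, hND]; push_cast; ring
  have hk : ‖1 - (2 * β - 1) * p‖ ^ 2 = 1 - (2 * β - 1) * ‖p‖ ^ 2 := by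
    rw [hp2, Complex.sq_norm, Complex.normSq_apply]
    simp
    rw [hp2] at h1
    nlinarith
  have hreD : (conj p * (1 - D - p)).re = p.re - m * β * ‖p‖ ^ 2 - ‖p‖ ^ 2 := by
    rw [hD]
    simp
    rw [hp2] at h1 ⊢
    linear_combination (-m) * h1
  have hple : β * ‖p‖ ≤ 1 := by
    rcases (norm_nonneg p).eq_or_lt with h | h
    · rw [← h]; simp
    · have := Complex.re_le_norm p
      rw [← h1] at this
      nlinarith
  rw [hk] at h3
  have hm' : 1 - (2 * β - 1) * ‖p‖ ^ 2 ≤ 2 * (1 - β) * m := by linarith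
  have hb2 : β ^ 2 * ‖p‖ ^ 2 ≤ 1 := by
    rw [← mul_pow]
    exact pow_le_one₀ (mul_nonneg (by linarith) (norm_nonneg p)) hple
  rw [hreD, hA, ← h1] at h5
  obtain ⟨h14, h13⟩ := eq_zero_of_convexity_inequalities hα hβ hβ1 hαβ hb (sq_nonneg ‖p‖) hσ hb2
    hm' h5
  -- What remains is the degenerate case `w(z) = 0`. There `h6` forces `D = 1`, hence `m = -1`,
  -- against the lower bound `hm'`.
  have h15 : p = 0 := by simpa using h14
  subst h15
  rw [h13] at h6
  simp at h6
  have h16 : (1 : ℂ) - D = 0 := h6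
  have h17 : D = 1 := by linear_combination -h16
  rw [h17] at hm
  simp at hm hm'
  rw [hm] at hm'
  linarith

/-! ### Second-order remainders with uniform constants. -/

open ComplexConjugate in
-- Expansion of the disc condition at a perturbed point, where `e` records the change of `‖z‖²`. The
-- error is `θ²` times a continuous function on a compact set.
theorem exists_tangential_remainder (β K : ℝ) : ∃ C, ∀ θ ∈ Icc (0 : ℝ) 1, ∀ p q E : ℂ, ∀ e : ℝ,
    ‖p‖ ≤ K → ‖q‖ ≤ K → ‖E‖ ≤ K → |e| ≤ K →
    β * ‖p‖ ^ 2 - p.re - θ * ((1 - 2 * β * conj p) * q).re ≤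
      β * ‖p + θ * q + θ ^ 2 * E‖ ^ 2 - (1 + θ ^ 2 * e) * (p + θ * q + θ ^ 2 * E).re +
        C * θ ^ 2 := by
  let g : ℝ × ℂ × ℂ × ℂ × ℝ → ℝ := fun x =>
    β * (2 * (conj x.2.1 * x.2.2.2.1).re + ‖x.2.2.1 + x.1 * x.2.2.2.1‖ ^ 2) - x.2.2.2.1.re -
      x.2.2.2.2 * (x.2.1 + x.1 * x.2.2.1 + x.1 ^ 2 * x.2.2.2.1).re
  have hg : Continuous g := by
    have := Complex.continuous_re
    have := Complex.continuous_conj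
    fun_prop
  have hK : IsCompact (Icc (0 : ℝ) 1 ×ˢ closedBall (0 : ℂ) K ×ˢ closedBall (0 : ℂ) K ×ˢ
      closedBall (0 : ℂ) K ×ˢ closedBall (0 : ℝ) K) :=
    isCompact_Icc.prod ((isCompact_closedBall _ _).prod ((isCompact_closedBall _ _).prod
      ((isCompact_closedBall _ _).prod (isCompact_closedBall _ _))))
  obtain ⟨C, hC⟩ := hK.exists_bound_of_continuousOn hg.continuousOn
  refine ⟨C, fun θ hθ p q E e hp hq hE he => ?_⟩
  have h1 := hC (θ, p, q, E, e) ⟨hθ, by simpa using hp, by simpa using hq, by simpa using hE,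
    by simpa using he⟩
  have h2 := neg_le_of_abs_le h1
  have h3 : β * ‖p + θ * q + θ ^ 2 * E‖ ^ 2 - (1 + θ ^ 2 * e) * (p + θ * q + θ ^ 2 * E).re =
      β * ‖p‖ ^ 2 - p.re - θ * ((1 - 2 * β * conj p) * q).re + θ ^ 2 * g (θ, p, q, E, e) := by
    simp only [g, Complex.sq_norm, Complex.normSq_apply]
    simp [← Complex.ofReal_pow]
    ring
  rw [h3]
  nlinarith [sq_nonneg θ]

open ComplexConjugate in
-- The same for the Schwarz inequality at `(1 - θ)z`. The leading term comes from `|1 - p|² - |1 -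
-- (2β - 1)p|² = 4(1 - β)(β|p|² - Re p)`.
theorem exists_radial_remainder (β K : ℝ) : ∃ C, ∀ θ ∈ Icc (0 : ℝ) 1, ∀ p D E : ℂ,
    ‖p‖ ≤ K → ‖D‖ ≤ K → ‖E‖ ≤ K →
    4 * (1 - β) * (β * ‖p‖ ^ 2 - p.re) * (1 - 4 * θ) +
      θ * (4 * (1 - β) * ((1 - 2 * β * conj p) * D).re + 2 * ‖1 - (2 * β - 1) * p‖ ^ 2) ≤
      ‖(1 - θ) ^ 2 - (p - θ * (D + 2 * p) + θ ^ 2 * E)‖ ^ 2 - (1 - θ) ^ 2 *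
        ‖(1 - θ) ^ 2 - (2 * β - 1) * (p - θ * (D + 2 * p) + θ ^ 2 * E)‖ ^ 2 + C * θ ^ 2 := by
  let Q : ℂ → ℂ → ℂ → ℝ → ℝ := fun a a' a'' θ => 2 * (conj a * a'').re + ‖a' + θ * a''‖ ^ 2
  let g : ℝ × ℂ × ℂ × ℂ → ℝ := fun x =>
    Q (1 - x.2.1) (-2 + x.2.2.1 + 2 * x.2.1) (1 - x.2.2.2) x.1 -
    (Q (1 - (2 * β - 1) * x.2.1) (-2 + (2 * β - 1) * (x.2.2.1 + 2 * x.2.1))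
      (1 - (2 * β - 1) * x.2.2.2) x.1 * (1 - x.1) ^ 2
      - 2 * (2 * (conj (1 - (2 * β - 1) * x.2.1) *
        (-2 + (2 * β - 1) * (x.2.2.1 + 2 * x.2.1))).re) + ‖1 - (2 * β - 1) * x.2.1‖ ^ 2
      + x.1 * (2 * (conj (1 - (2 * β - 1) * x.2.1) *
        (-2 + (2 * β - 1) * (x.2.2.1 + 2 * x.2.1))).re))
  have hg : Continuous g := by
    have := Complex.continuous_re
    have := Complex.continuous_conj
    fun_prop
  have hK : IsCompact (Icc (0 : ℝ) 1 ×ˢ closedBall (0 : ℂ) K ×ˢ closedBall (0 : ℂ) K ×ˢ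
      closedBall (0 : ℂ) K) :=
    isCompact_Icc.prod ((isCompact_closedBall _ _).prod ((isCompact_closedBall _ _).prod
      (isCompact_closedBall _ _)))
  obtain ⟨C, hC⟩ := hK.exists_bound_of_continuousOn hg.continuousOn
  refine ⟨C, fun θ hθ p D E hp hD hE => ?_⟩
  have h1 := hC (θ, p, D, E) ⟨hθ, by simpa using hp, by simpa using hD, by simpa using hE⟩
  have h2 := neg_le_of_abs_le h1
  have h3 : ‖(1 - θ) ^ 2 - (p - θ * (D + 2 * p) + θ ^ 2 * E)‖ ^ 2 - (1 - θ) ^ 2 *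
        ‖(1 - θ) ^ 2 - (2 * β - 1) * (p - θ * (D + 2 * p) + θ ^ 2 * E)‖ ^ 2 =
      4 * (1 - β) * (β * ‖p‖ ^ 2 - p.re) * (1 - 4 * θ) +
      θ * (4 * (1 - β) * ((1 - 2 * β * conj p) * D).re + 2 * ‖1 - (2 * β - 1) * p‖ ^ 2) +
      θ ^ 2 * g (θ, p, D, E) := by
    have e : ((1 : ℂ) - θ) ^ 2 = (((1 - θ) ^ 2 : ℝ) : ℂ) := by push_cast; ring
    simp only [g, Q, Complex.sq_norm, Complex.normSq_apply, e]
    simp [← Complex.ofReal_pow]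
    ring
  rw [h3]
  nlinarith [sq_nonneg θ]

theorem nonpos_of_add_mul_le_sq {g x C δ : ℝ} (hδ : 0 < δ) (hg : 0 ≤ g)
    (h : ∀ θ ∈ Ioo 0 δ, g + θ * x ≤ C * θ ^ 2) : x ≤ 0 := by
  have h1 : Tendsto (fun θ : ℝ => C * θ) (𝓝[>] 0) (𝓝 0) := by
    have : Continuous fun θ : ℝ => C * θ := by fun_prop
    simpa using (this.tendsto 0).mono_left nhdsWithin_le_nhds
  refine ge_of_tendsto h1 ?_
  filter_upwards [Ioo_mem_nhdsGT hδ] with θ hθ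
  have := h θ hθ
  have hpos := hθ.1
  refine le_of_mul_le_mul_left ?_ hpos
  linarith

/-! ### The disc condition on slices and Schwarz's lemma. -/

section Schwarz

variable {X : Type*} [NormedAddCommGroup X] [InnerProductSpace ℂ X]

/-- The inequality `starForm β w z ≤ 0` says that `p = ⟨w(z), z⟩ / ‖z‖²` lies in the closed disc
`β |p|² ≤ Re p`. -/
noncomputable def starForm (β : ℝ) (w : X → X) (z : X) : ℝ :=
  β * ‖inner ℂ z (w z)‖ ^ 2 - ‖z‖ ^ 2 * (inner ℂ z (w z)).re

theorem starForm_smul_of_ne_zero {β : ℝ} {w : X → X} {z : X} {ζ : ℂ} (hz : z ≠ 0) (hζ : ζ ≠ 0)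
    (h : starForm β w (ζ • z) ≤ 0) :
    β * ‖ζ⁻¹ * (inner ℂ z (w (ζ • z)) / ‖z‖ ^ 2)‖ ^ 2 ≤
      (ζ⁻¹ * (inner ℂ z (w (ζ • z)) / ‖z‖ ^ 2)).re := by
  have hz' := norm_pos_iff.2 hz
  have hζ' := norm_pos_iff.2 hζ
  have hzc : (‖z‖ : ℂ) ≠ 0 := by exact_mod_cast hz'.ne'
  have hs : (0 : ℝ) < ‖ζ‖ ^ 2 * ‖z‖ ^ 2 := by positivity
  set p := ζ⁻¹ * (inner ℂ z (w (ζ • z)) / ‖z‖ ^ 2) with hp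
  have e : inner ℂ (ζ • z) (w (ζ • z)) = ((‖ζ‖ ^ 2 * ‖z‖ ^ 2 : ℝ) : ℂ) * p := by
    rw [inner_smul_left, hp]
    push_cast
    rw [← Complex.conj_mul']
    field_simp
  rw [starForm, e, norm_mul, Complex.re_ofReal_mul, Complex.norm_real, norm_smul,
    Real.norm_of_nonneg hs.le] at h
  have : (‖ζ‖ ^ 2 * ‖z‖ ^ 2) ^ 2 * (β * ‖p‖ ^ 2) ≤ (‖ζ‖ ^ 2 * ‖z‖ ^ 2) ^ 2 * p.re := by
    nlinarith
  exact le_of_mul_le_mul_left this (by positivity)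

theorem norm_one_sub_le_of_disc {β : ℝ} (hβ1 : β < 1) {p : ℂ} (h : β * ‖p‖ ^ 2 ≤ p.re) :
    ‖1 - p‖ ≤ ‖1 - (2 * β - 1) * p‖ := by
  rw [← sq_le_sq₀ (norm_nonneg _) (norm_nonneg _)]
  rw [Complex.sq_norm, Complex.normSq_apply] at h ⊢
  rw [Complex.sq_norm, Complex.normSq_apply]
  simp
  nlinarith [mul_le_mul_of_nonneg_left h (by linarith : 0 ≤ 1 - β)]

theorem one_sub_mul_ne_zero_of_disc {β : ℝ} (hβ1 : β < 1) {p : ℂ} (h : β * ‖p‖ ^ 2 ≤ p.re) :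
    1 - (2 * β - 1) * p ≠ 0 := by
  intro h0
  have h1 := norm_one_sub_le_of_disc hβ1 h
  rw [h0, norm_zero] at h1
  have h2 : p = 1 := by
    have := norm_le_zero_iff.1 h1
    linear_combination -this
  rw [h2] at h0
  have h3 := congrArg Complex.re h0
  simp at h3
  linarith

/-- On a slice, `p(ζ) = ⟨w(ζz), z⟩ / (ζ‖z‖²)` is holomorphic with `p(0) = 1`, and `(1 - p) / (1 -
(2β - 1)p)` sends the disc `β|p|² ≤ Re p` into the unit disc and `1` to `0`. A general radius `r` is
needed because the lemma also serves inside the continuity argument, before the whole ball is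
reached. -/
theorem norm_sub_inner_le_of_starForm_nonpos {β r : ℝ} (hβ1 : β < 1) {w : X → X}
    (hw : DifferentiableOn ℂ w (ball 0 r)) (hw0 : w 0 = 0)
    (hw1 : fderiv ℂ w 0 = ContinuousLinearMap.id ℂ X)
    (hF : ∀ z ∈ ball (0 : X) r, starForm β w z ≤ 0) {z : X} (hz : z ∈ ball (0 : X) r) :
    r * ‖(‖z‖ : ℂ) ^ 2 - inner ℂ z (w z)‖ ≤
      ‖z‖ * ‖(‖z‖ : ℂ) ^ 2 - (2 * β - 1) * inner ℂ z (w z)‖ := by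
  rcases eq_or_ne z 0 with rfl | hz0
  · simp
  have hzpos := norm_pos_iff.2 hz0
  have hzc : (‖z‖ : ℂ) ≠ 0 := by exact_mod_cast hzpos.ne'
  rw [mem_ball_zero_iff] at hz
  have hrpos : 0 < r := hzpos.trans hz
  have hmem : ∀ ζ ∈ ball (0 : ℂ) (r / ‖z‖), ζ • z ∈ ball (0 : X) r := by
    intro ζ hζ
    rw [mem_ball_zero_iff] at hζ ⊢
    rw [norm_smul]
    exact (lt_div_iff₀ hzpos).1 hζ
  set W : ℂ → ℂ := fun ζ => inner ℂ z (w (ζ • z)) / ‖z‖ ^ 2 with hW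
  have hWd : DifferentiableOn ℂ W (ball 0 (r / ‖z‖)) := by
    refine DifferentiableOn.div_const ?_ _
    exact (innerSL ℂ z).differentiable.comp_differentiableOn (hw.comp (by fun_prop) hmem)
  have hW0 : W 0 = 0 := by simp [hW, hw0]
  have hR : 0 < r / ‖z‖ := by positivity
  have hW1 : deriv W 0 = 1 := by
    have h1 : DifferentiableAt ℂ w (0 + (0 : ℂ) • z) := by
      simpa using hw.differentiableAt (ball_mem_nhds _ hrpos)
    have h2 := ((innerSL ℂ z).hasFDerivAt.comp_hasDerivAt _ (hasDerivAt_line h1)).div_const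
      ((‖z‖ : ℂ) ^ 2)
    have h3 := h2.deriv
    simp only [zero_smul, zero_add, add_zero, hw1] at h3
    have h4 : (fun ζ : ℂ => (⇑((innerSL ℂ) z) ∘ fun ζ : ℂ => w (ζ • z)) ζ / (‖z‖ : ℂ) ^ 2) = W := by
      funext ζ; simp [hW]
    rw [h4] at h3
    rw [h3]
    simp only [ContinuousLinearMap.id_apply, innerSL_apply_apply, inner_self_eq_norm_sq_to_K]
    exact div_self (pow_ne_zero 2 hzc)
  set p : ℂ → ℂ := dslope W 0 with hp
  have hpd : DifferentiableOn ℂ p (ball 0 (r / ‖z‖)) :=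
    (Complex.differentiableOn_dslope (ball_mem_nhds _ hR)).2 hWd
  have hp0 : p 0 = 1 := by rw [hp, dslope_same, hW1]
  have hpζ : ∀ ζ, ζ ≠ 0 → p ζ = ζ⁻¹ * W ζ := by
    intro ζ hζ
    rw [hp, dslope_of_ne _ hζ, slope_def_field, hW0]
    field_simp
    simp
  have hdisc : ∀ ζ ∈ ball (0 : ℂ) (r / ‖z‖), β * ‖p ζ‖ ^ 2 ≤ (p ζ).re := by
    intro ζ hζ
    rcases eq_or_ne ζ 0 with rfl | hζ0
    · rw [hp0]; simpa using hβ1.le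
    · rw [hpζ ζ hζ0]
      exact starForm_smul_of_ne_zero hz0 hζ0 (hF _ (hmem ζ hζ))
  have h1mem : (1 : ℂ) ∈ ball (0 : ℂ) (r / ‖z‖) := by
    rw [mem_ball_zero_iff, norm_one, lt_div_iff₀ hzpos, one_mul]; exact hz
  have key := Complex.dist_le_div_mul_dist_of_mapsTo_ball
    (f := fun ζ => (1 - p ζ) / (1 - (2 * β - 1) * p ζ)) (R₂ := 1)
    (((differentiableOn_const _).sub hpd).div
      ((differentiableOn_const _).sub ((differentiableOn_const _).mul hpd))
      fun ζ hζ => one_sub_mul_ne_zero_of_disc hβ1 (hdisc ζ hζ))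
    (fun ζ hζ => by
      simp only [hp0, sub_self, zero_div, mem_closedBall, dist_zero_right, norm_div]
      exact div_le_one_of_le₀ (norm_one_sub_le_of_disc hβ1 (hdisc ζ hζ)) (norm_nonneg _)) h1mem
  have hne := norm_pos_iff.2 (one_sub_mul_ne_zero_of_disc hβ1 (hdisc 1 h1mem))
  simp only [hp0, sub_self, zero_div, dist_zero_right, norm_div, norm_one, mul_one] at key
  rw [div_le_iff₀ hne] at key
  have hp1 : p 1 = inner ℂ z (w z) / ‖z‖ ^ 2 := by rw [hpζ 1 one_ne_zero]; simp [hW]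
  have e1 : (‖z‖ : ℂ) ^ 2 - inner ℂ z (w z) = ((‖z‖ ^ 2 : ℝ) : ℂ) * (1 - p 1) := by
    rw [hp1]; push_cast; field_simp
  have e2 : (‖z‖ : ℂ) ^ 2 - (2 * β - 1) * inner ℂ z (w z) =
      ((‖z‖ ^ 2 : ℝ) : ℂ) * (1 - (2 * β - 1) * p 1) := by
    rw [hp1]; push_cast; field_simp
  rw [e1, e2, norm_mul, norm_mul, Complex.norm_real, Real.norm_of_nonneg (by positivity)]
  have h5 : r * ‖1 - p 1‖ ≤ ‖z‖ * ‖1 - (2 * β - 1) * p 1‖ := by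
    calc r * ‖1 - p 1‖ ≤ r * (1 / (r / ‖z‖) * ‖1 - (2 * β - 1) * p 1‖) := by gcongr
      _ = _ := by field_simp
  nlinarith [sq_nonneg ‖z‖]

end Schwarz

/-! ### Variational inequalities on a sphere. -/

namespace IsConvexOfOrder

variable {X : Type*} [NormedAddCommGroup X] [InnerProductSpace ℂ X] [CompleteSpace X]
  {f : X → X} {α : ℝ}

theorem exists_radialField_taylor (hf : IsConvexOfOrder α f) (hα : α < 1) (h0 : f 0 = 0) {r : ℝ}
    (hr : r < 1) : ∃ L, 0 ≤ L ∧ ∃ δ > 0, δ ≤ 1 - r ∧ ∀ z : X, ‖z‖ ≤ r → ‖radialField f z‖ ≤ L ∧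
      ‖fderiv ℂ (radialField f) z‖ ≤ L ∧ ∀ h, ‖h‖ < δ →
      ‖radialField f (z + h) - radialField f z - fderiv ℂ (radialField f) z h‖ ≤ L * ‖h‖ ^ 2 := by
  set R := (1 - r) / 2 with hR
  have hRpos : 0 < R := by rw [hR]; linarith
  obtain ⟨K, hK0, hK⟩ := hf.exists_norm_radialField_le hα h0 (ρ := r + R) (by rw [hR]; linarith)
  refine ⟨K + 2 * K / R + 4 * K / R ^ 2, by positivity, R, hRpos, by rw [hR]; linarith,
    fun z hz => ?_⟩
  have hmem : ∀ y ∈ ball z R, ‖y‖ ≤ r + R := by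
    intro y hy
    rw [mem_ball, dist_eq_norm] at hy
    have := norm_sub_norm_le y z
    linarith
  have hd : DifferentiableOn ℂ (radialField f) (ball z R) :=
    hf.1.differentiableOn_radialField.mono fun y hy => mem_ball_zero_iff.2
      ((hmem y hy).trans_lt (by rw [hR]; linarith))
  have hb : ∀ y ∈ ball z R, ‖radialField f y‖ ≤ K := fun y hy => hK y (hmem y hy)
  have h1 : 0 ≤ 2 * K / R := by positivity
  have h2 : 0 ≤ 4 * K / R ^ 2 := by positivity
  refine ⟨?_, ?_, fun h hh => ?_⟩
  · linarith [hb z (mem_ball_self hRpos)]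
  · linarith [norm_fderiv_le_of_bounded hRpos hd hb]
  · refine (norm_sub_sub_fderiv_le hd hb hh).trans ?_
    have : 4 * K * (‖h‖ / R) ^ 2 = 4 * K / R ^ 2 * ‖h‖ ^ 2 := by field_simp
    rw [this]
    gcongr
    linarith

theorem exists_inner_radialField_taylor (hf : IsConvexOfOrder α f) (hα : α < 1) (h0 : f 0 = 0)
    {r : ℝ} (hr : r < 1) : ∃ L, 0 ≤ L ∧ ∃ δ > 0, ∀ z : X, ‖z‖ ≤ r →
      ‖radialField f z‖ ≤ L ∧ ‖fderiv ℂ (radialField f) z‖ ≤ L ∧ ∀ h, ‖h‖ < δ →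
      ‖inner ℂ (z + h) (radialField f (z + h)) - inner ℂ z (radialField f z) -
        (inner ℂ z (fderiv ℂ (radialField f) z h) + inner ℂ h (radialField f z))‖ ≤
        L * ‖h‖ ^ 2 := by
  obtain ⟨L, hL, δ, hδ, hδr, H⟩ := hf.exists_radialField_taylor hα h0 hr
  refine ⟨2 * L, by linarith, δ, hδ, fun z hz => ?_⟩
  obtain ⟨h1, h2, h3⟩ := H z hz
  refine ⟨by linarith, by linarith, fun h hh => ?_⟩
  set w := radialField f
  have e : inner ℂ (z + h) (w (z + h)) - inner ℂ z (w z) -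
      (inner ℂ z (fderiv ℂ w z h) + inner ℂ h (w z)) =
      inner ℂ (z + h) (w (z + h) - w z - fderiv ℂ w z h) + inner ℂ h (fderiv ℂ w z h) := by
    simp only [inner_add_left, inner_sub_right]; ring
  rw [e]
  have hzh : ‖z + h‖ ≤ 1 := by linarith [norm_add_le z h]
  calc _ ≤ ‖z + h‖ * ‖w (z + h) - w z - fderiv ℂ w z h‖ + ‖h‖ * ‖fderiv ℂ w z h‖ :=
        (norm_add_le _ _).trans (add_le_add (norm_inner_le_norm _ _) (norm_inner_le_norm _ _))
    _ ≤ 1 * (L * ‖h‖ ^ 2) + ‖h‖ * (L * ‖h‖) := by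
        gcongr
        · exact h3 h hh
        · exact (fderiv ℂ w z).le_of_opNorm_le h2 h
    _ = 2 * L * ‖h‖ ^ 2 := by ring

theorem fderiv_radialField_zero (hf : IsConvexOfOrder α f) (h0 : f 0 = 0) :
    fderiv ℂ (radialField f) 0 = ContinuousLinearMap.id ℂ X := by
  ext x
  rw [hf.1.fderiv_radialField (mem_ball_self one_pos), radialField_zero h0]
  simp

open ComplexConjugate in
set_option maxHeartbeats 800000 in
-- A tangential step `θy` leaves the ball of radius `r` by `O(θ²)`; the correction `-cθ²z` returns
-- to it, so that `hF` applies, at a cost of order `θ²`.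
theorem exists_tangential_bound (hf : IsConvexOfOrder α f) (hα : α < 1) (h0 : f 0 = 0) {β r : ℝ}
    (hr0 : 0 < r) (hr1 : r < 1) (hF : ∀ z, ‖z‖ ≤ r → starForm β (radialField f) z ≤ 0) {M : ℝ}
    (hM : 0 ≤ M) : ∃ C, ∃ δ > 0, ∀ z : X, ‖z‖ = r → ∀ y, (inner ℂ z y).re = 0 → ‖y‖ ≤ M →
      ∀ θ ∈ Ioo 0 δ, β * ‖inner ℂ z (radialField f z) / (r : ℂ) ^ 2‖ ^ 2 -
        (inner ℂ z (radialField f z) / (r : ℂ) ^ 2).re -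
        θ * ((1 - 2 * β * conj (inner ℂ z (radialField f z) / (r : ℂ) ^ 2)) *
          ((inner ℂ z (fderiv ℂ (radialField f) z y) + inner ℂ y (radialField f z)) /
            (r : ℂ) ^ 2)).re ≤ C * θ ^ 2 := by
  obtain ⟨L, hL, δ, hδ, H⟩ := hf.exists_inner_radialField_taylor hα h0 hr1
  set w := radialField f
  -- Chosen so that in `e` below the term `-2c` absorbs both `‖y‖² / r² ≤ c` and, for `θ < 1/c`,
  -- `c²θ² ≤ c`.
  set c := M ^ 2 / r ^ 2 + 1 with hc
  have hc1 : 1 ≤ c := by rw [hc]; linarith [show 0 ≤ M ^ 2 / r ^ 2 by positivity]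
  have hMc : 0 < M + c := by linarith
  set K := L / r ^ 2 + 2 * M * L / r ^ 2 + (c * (2 * L) + L * (M + c) ^ 2) / r ^ 2 + 3 * c with hK
  have k1 : 0 ≤ L / r ^ 2 := by positivity
  have k2 : 0 ≤ 2 * M * L / r ^ 2 := by positivity
  have k3 : 0 ≤ (c * (2 * L) + L * (M + c) ^ 2) / r ^ 2 := by positivity
  obtain ⟨C, hC⟩ := exists_tangential_remainder β K
  refine ⟨C, min (δ / (M + c)) (1 / c), by positivity, fun z hz y hy hyM θ hθ => ?_⟩
  obtain ⟨hθ0, hθ1⟩ := hθ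
  obtain ⟨hθδ, hθc⟩ := lt_min_iff.1 hθ1
  rw [lt_div_iff₀ hMc] at hθδ
  rw [lt_div_iff₀ (by linarith)] at hθc
  have hθ1 : θ ≤ 1 := by nlinarith
  obtain ⟨b1, b2, b3⟩ := H z hz.le
  set h : X := (θ : ℂ) • y - ((c * θ ^ 2 : ℝ) : ℂ) • z with hh
  have hhn : ‖h‖ ≤ θ * (M + c) := by
    rw [hh]
    refine (norm_sub_le _ _).trans ?_
    rw [norm_smul, norm_smul, Complex.norm_real, Complex.norm_real, Real.norm_of_nonneg hθ0.le,
      Real.norm_of_nonneg (by positivity), hz]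
    have : c * θ ^ 2 * r ≤ c * θ := by
      have : θ * r ≤ 1 := by nlinarith only [hθ0, hθ1, hr0, hr1]
      nlinarith only [mul_pos (by linarith : 0 < c) hθ0, this]
    nlinarith only [this, hyM, hθ0]
  have hb := b3 h (hhn.trans_lt hθδ)
  set e0 := inner ℂ (z + h) (w (z + h)) - inner ℂ z (w z) -
        (inner ℂ z (fderiv ℂ w z h) + inner ℂ h (w z)) with he0
  have he0n : ‖e0‖ ≤ L * (M + c) ^ 2 * θ ^ 2 := by
    calc ‖e0‖ ≤ L * ‖h‖ ^ 2 := hb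
      _ ≤ L * (θ * (M + c)) ^ 2 := by gcongr
      _ = _ := by ring
  have hrc : (r : ℂ) ≠ 0 := by exact_mod_cast hr0.ne'
  have hθc' : (θ : ℂ) ≠ 0 := by exact_mod_cast hθ0.ne'
  have hr2 : ‖(r : ℂ) ^ 2‖ = r ^ 2 := by rw [norm_pow, Complex.norm_real, Real.norm_of_nonneg hr0.le]
  set p := inner ℂ z (w z) / (r : ℂ) ^ 2 with hp
  set q := (inner ℂ z (fderiv ℂ w z y) + inner ℂ y (w z)) / (r : ℂ) ^ 2 with hq
  set E := (-(c : ℂ) * (inner ℂ z (fderiv ℂ w z z) + inner ℂ z (w z)) + e0 / (θ : ℂ) ^ 2) /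
    (r : ℂ) ^ 2 with hE
  set e := -2 * c + ‖y‖ ^ 2 / r ^ 2 + c ^ 2 * θ ^ 2 with he
  have hzw : ‖inner ℂ z (w z)‖ ≤ L := by
    refine (norm_inner_le_norm _ _).trans ?_
    rw [hz]
    nlinarith only [norm_nonneg (w z), b1, hr0, hr1]
  have hzD : ∀ y, ‖inner ℂ z (fderiv ℂ w z y)‖ ≤ L * ‖y‖ := by
    intro y
    refine (norm_inner_le_norm _ _).trans ?_
    rw [hz]
    have := (fderiv ℂ w z).le_of_opNorm_le b2 y
    nlinarith only [norm_nonneg (fderiv ℂ w z y), this, hr0, hr1]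
  have hpK : ‖p‖ ≤ K := by
    have : ‖p‖ ≤ L / r ^ 2 := by rw [hp, norm_div, hr2]; gcongr
    linarith
  have hqK : ‖q‖ ≤ K := by
    have : ‖q‖ ≤ 2 * M * L / r ^ 2 := by
      rw [hq, norm_div, hr2]
      gcongr
      refine (norm_add_le _ _).trans ?_
      have h2 : ‖inner ℂ y (w z)‖ ≤ M * L :=
        (norm_inner_le_norm _ _).trans (by gcongr)
      have h3 := (hzD y).trans (mul_le_mul_of_nonneg_left hyM hL)
      linarith
    linarith
  have hEK : ‖E‖ ≤ K := by
    have : ‖E‖ ≤ (c * (2 * L) + L * (M + c) ^ 2) / r ^ 2 := by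
      rw [hE, norm_div, hr2]
      gcongr
      refine (norm_add_le _ _).trans (add_le_add ?_ ?_)
      · rw [norm_mul, norm_neg, Complex.norm_real, Real.norm_of_nonneg (by linarith)]
        gcongr
        refine (norm_add_le _ _).trans ?_
        have := hzD z
        rw [hz] at this
        linarith [mul_le_of_le_one_right hL hr1.le]
      · rw [norm_div, norm_pow, Complex.norm_real, Real.norm_of_nonneg hθ0.le,
          div_le_iff₀ (by positivity)]
        exact he0n
    linarith
  have hyc : ‖y‖ ^ 2 / r ^ 2 ≤ c := by
    have : ‖y‖ ^ 2 / r ^ 2 ≤ M ^ 2 / r ^ 2 := by gcongr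
    linarith
  have hcθ : c ^ 2 * θ ^ 2 ≤ c := by
    have h1 : c * θ * (c * θ) ≤ c * θ * 1 := by
      apply mul_le_mul_of_nonneg_left _ (by positivity)
      linarith
    nlinarith
  have hy0 : 0 ≤ ‖y‖ ^ 2 / r ^ 2 := by positivity
  have hc0 : 0 ≤ c ^ 2 * θ ^ 2 := by positivity
  have heK : |e| ≤ K := by
    rw [abs_le]; constructor <;> linarith
  have hPh : inner ℂ (z + h) (w (z + h)) = ((r ^ 2 : ℝ) : ℂ) * (p + θ * q + θ ^ 2 * E) := by
    have h1 : inner ℂ z (fderiv ℂ w z h) + inner ℂ h (w z) =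
        θ * (inner ℂ z (fderiv ℂ w z y) + inner ℂ y (w z)) -
          c * θ ^ 2 * (inner ℂ z (fderiv ℂ w z z) + inner ℂ z (w z)) := by
      rw [hh]
      simp only [map_sub, map_smul, inner_sub_right, inner_sub_left, inner_smul_left,
        inner_smul_right, Complex.conj_ofReal]
      push_cast; ring
    have h2 : inner ℂ (z + h) (w (z + h)) = inner ℂ z (w z) +
        (inner ℂ z (fderiv ℂ w z h) + inner ℂ h (w z)) + e0 := by rw [he0]; ring
    rw [h2, h1, hp, hq, hE]
    push_cast
    field_simp
    ring
  have hnorm : ‖z + h‖ ^ 2 = r ^ 2 * (1 + θ ^ 2 * e) := by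
    have h1 : z + h = ((1 - c * θ ^ 2 : ℝ) : ℂ) • z + (θ : ℂ) • y := by
      rw [hh]; push_cast; module
    rw [h1, @norm_add_sq ℂ, inner_smul_left, inner_smul_right, norm_smul, norm_smul,
      Complex.norm_real, Complex.norm_real, mul_pow, mul_pow, Real.norm_eq_abs, Real.norm_eq_abs,
      sq_abs, sq_abs, hz, Complex.conj_ofReal]
    have h2 : RCLike.re (((1 - c * θ ^ 2 : ℝ) : ℂ) * ((θ : ℂ) * inner ℂ z y)) = 0 := by
      rw [← mul_assoc, ← Complex.ofReal_mul]
      simp only [RCLike.re_to_complex, Complex.re_ofReal_mul, hy, mul_zero]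
    rw [h2, he]
    field_simp
    ring
  have hle : ‖z + h‖ ≤ r := by
    rw [← sq_le_sq₀ (norm_nonneg _) hr0.le, hnorm]
    have : e ≤ 0 := by linarith
    nlinarith [mul_nonneg (sq_nonneg r) (sq_nonneg θ)]
  have hneg := hF _ hle
  rw [starForm, hPh, hnorm, norm_mul, Complex.re_ofReal_mul, Complex.norm_real,
    Real.norm_of_nonneg (by positivity)] at hneg
  have hfin : β * ‖p + θ * q + θ ^ 2 * E‖ ^ 2 - (1 + θ ^ 2 * e) * (p + θ * q + θ ^ 2 * E).re ≤ 0 := by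
    have hr4 : 0 < r ^ 2 * r ^ 2 := by positivity
    refine le_of_mul_le_mul_left ?_ hr4
    rw [mul_zero]
    refine le_trans (le_of_eq ?_) hneg
    ring
  linarith [hC θ ⟨hθ0.le, hθ1⟩ p q E e hpK hqK hEK heK]

open ComplexConjugate in
-- Schwarz's lemma is used just inside the sphere, at `(1 - θ)z`. Its factor `1 - θ` yields a
-- quantitative bound on the radial derivative of `p`, not merely its sign.
theorem exists_radial_bound (hf : IsConvexOfOrder α f) (hα : α < 1) (h0 : f 0 = 0) {β r : ℝ}
    (hβ : β < 1) (hr0 : 0 < r) (hr1 : r < 1)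
    (hF : ∀ z, ‖z‖ ≤ r → starForm β (radialField f) z ≤ 0) :
    ∃ C, ∃ δ > 0, ∀ z : X, ‖z‖ = r → ∀ θ ∈ Ioo 0 δ, ∀ p D : ℂ,
      p = inner ℂ z (radialField f z) / (r : ℂ) ^ 2 →
      D = inner ℂ z (fderiv ℂ (radialField f) z z) / (r : ℂ) ^ 2 - p →
      4 * (1 - β) * (β * ‖p‖ ^ 2 - p.re) * (1 - 4 * θ) + θ * (4 * (1 - β) *
        ((1 - 2 * β * conj p) * D).re + 2 * ‖1 - (2 * β - 1) * p‖ ^ 2) ≤ C * θ ^ 2 := by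
  obtain ⟨L, hL, δ, hδ, H⟩ := hf.exists_inner_radialField_taylor hα h0 hr1
  set w := radialField f
  set K := 2 * L / r ^ 2 with hK
  obtain ⟨C, hC⟩ := exists_radial_remainder β K
  refine ⟨C, min δ 1, by positivity, fun z hz θ hθ p D hp hD => ?_⟩
  obtain ⟨hθ0, hθ1⟩ := hθ
  obtain ⟨hθδ, hθ1⟩ := lt_min_iff.1 hθ1
  obtain ⟨b1, b2, b3⟩ := H z hz.le
  set h : X := -(θ : ℂ) • z with hh
  have hhn : ‖h‖ = θ * r := by
    rw [hh, norm_smul, norm_neg, Complex.norm_real, Real.norm_of_nonneg hθ0.le, hz]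
  have hb := b3 h (by rw [hhn]; nlinarith)
  set e0 := inner ℂ (z + h) (w (z + h)) - inner ℂ z (w z) -
        (inner ℂ z (fderiv ℂ w z h) + inner ℂ h (w z)) with he0
  have he0n : ‖e0‖ ≤ L * θ ^ 2 := by
    rw [hhn] at hb
    have : (θ * r) ^ 2 ≤ θ ^ 2 := by
      rw [mul_pow]
      exact mul_le_of_le_one_right (by positivity) (pow_le_one₀ hr0.le hr1.le)
    nlinarith
  have hrc : (r : ℂ) ≠ 0 := by exact_mod_cast hr0.ne'
  have hθc' : (θ : ℂ) ≠ 0 := by exact_mod_cast hθ0.ne'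
  have hr2 : ‖(r : ℂ) ^ 2‖ = r ^ 2 := by rw [norm_pow, Complex.norm_real, Real.norm_of_nonneg hr0.le]
  set E := e0 / (θ : ℂ) ^ 2 / (r : ℂ) ^ 2 with hE
  have hzw : ‖inner ℂ z (w z)‖ ≤ L := by
    refine (norm_inner_le_norm _ _).trans ?_
    rw [hz]
    nlinarith only [norm_nonneg (w z), b1, hr0, hr1]
  have hzD : ‖inner ℂ z (fderiv ℂ w z z)‖ ≤ L := by
    refine (norm_inner_le_norm _ _).trans ?_
    rw [hz]
    have := (fderiv ℂ w z).le_of_opNorm_le b2 z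
    rw [hz] at this
    nlinarith [norm_nonneg (fderiv ℂ w z z)]
  have hpK : ‖p‖ ≤ K := by
    rw [hp, norm_div, hr2, hK]; gcongr; linarith
  have hDK : ‖D‖ ≤ K := by
    rw [hD, hp, ← sub_div, norm_div, hr2, hK]
    gcongr
    linarith [norm_sub_le (inner ℂ z (fderiv ℂ w z z)) (inner ℂ z (w z))]
  have hEK : ‖E‖ ≤ K := by
    rw [hE, norm_div, hr2, hK]
    gcongr
    rw [norm_div, norm_pow, Complex.norm_real, Real.norm_of_nonneg hθ0.le,
          div_le_iff₀ (by positivity)]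
    nlinarith [sq_nonneg θ]
  have hPh : inner ℂ (z + h) (w (z + h)) =
      ((r ^ 2 : ℝ) : ℂ) * (p - θ * (D + 2 * p) + θ ^ 2 * E) := by
    have h1 : inner ℂ z (fderiv ℂ w z h) + inner ℂ h (w z) =
        -θ * (inner ℂ z (fderiv ℂ w z z) + inner ℂ z (w z)) := by
      rw [hh]
      simp only [map_smul, inner_smul_left, inner_smul_right, map_neg, Complex.conj_ofReal]
      ring
    have h2 : inner ℂ (z + h) (w (z + h)) = inner ℂ z (w z) +
        (inner ℂ z (fderiv ℂ w z h) + inner ℂ h (w z)) + e0 := by rw [he0]; ring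
    rw [h2, h1, hD, hp, hE]
    push_cast
    field_simp
    ring
  have hzh : z + h = ((1 - θ : ℝ) : ℂ) • z := by rw [hh]; push_cast; module
  have hnorm : ‖z + h‖ = (1 - θ) * r := by
    rw [hzh, norm_smul, Complex.norm_real, Real.norm_of_nonneg (by linarith), hz]
  have hsch := norm_sub_inner_le_of_starForm_nonpos (r := r) hβ
    (hf.1.differentiableOn_radialField.mono (ball_subset_ball hr1.le)) (radialField_zero h0)
    (hf.fderiv_radialField_zero h0) (fun y hy => hF y (mem_ball_zero_iff.1 hy).le)
    (z := z + h) (by rw [mem_ball_zero_iff, hnorm]; nlinarith)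
  set p1 := p - θ * (D + 2 * p) + θ ^ 2 * E with hp1
  rw [hPh, hnorm] at hsch
  have e1 : (((1 - θ) * r : ℝ) : ℂ) ^ 2 - ((r ^ 2 : ℝ) : ℂ) * p1 =
      ((r ^ 2 : ℝ) : ℂ) * ((1 - θ) ^ 2 - p1) := by push_cast; ring
  have e2 : (((1 - θ) * r : ℝ) : ℂ) ^ 2 - (2 * β - 1) * (((r ^ 2 : ℝ) : ℂ) * p1) =
      ((r ^ 2 : ℝ) : ℂ) * ((1 - θ) ^ 2 - (2 * β - 1) * p1) := by push_cast; ring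
  rw [e1, e2, norm_mul, norm_mul, Complex.norm_real, Real.norm_of_nonneg (by positivity)] at hsch
  have h5 : ‖(1 - θ : ℂ) ^ 2 - p1‖ ≤ (1 - θ) * ‖(1 - θ : ℂ) ^ 2 - (2 * β - 1) * p1‖ := by
    have : 0 < r * r ^ 2 := by positivity
    refine le_of_mul_le_mul_left ?_ this
    linarith
  have h6 : ‖(1 - θ : ℂ) ^ 2 - p1‖ ^ 2 ≤
      (1 - θ) ^ 2 * ‖(1 - θ : ℂ) ^ 2 - (2 * β - 1) * p1‖ ^ 2 := by
    rw [← mul_pow]; gcongr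
  have := hC θ ⟨hθ0.le, hθ1.le⟩ p D E hpK hDK hEK
  rw [← hp1] at this
  linarith

end IsConvexOfOrder

/-! ### Compactness of the first-order data. -/

section Admissible

open ComplexConjugate

/-- The possible values of the first order data `(p, D, A, σ)` of a convex mapping at the points
of a sphere. -/
def firstOrderData (β b C₁ δ₁ C₂ δ₂ C₃ K : ℝ) : Set (ℂ × ℂ × ℂ × ℝ) :=
  {d | 0 ≤ d.2.2.2 ∧ β * ‖d.1‖ ^ 2 - d.1.re ≤ 0 ∧
    (∀ θ ∈ Ioo 0 δ₁, β * ‖d.1‖ ^ 2 - d.1.re +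
      θ * |((1 - 2 * β * conj d.1) * d.2.1).im| ≤ C₁ * θ ^ 2) ∧
    (∀ θ ∈ Ioo 0 δ₁, β * ‖d.1‖ ^ 2 - d.1.re +
      θ * |((1 - 2 * β * conj d.1) * (d.2.2.1 + d.2.2.2)).re| ≤ C₁ * θ ^ 2) ∧
    (∀ θ ∈ Ioo 0 δ₁, β * ‖d.1‖ ^ 2 - d.1.re +
      θ * |((1 - 2 * β * conj d.1) * (d.2.2.1 - d.2.2.2)).im| ≤ C₁ * θ ^ 2) ∧
    (∀ θ ∈ Ioo 0 δ₂, 4 * (1 - β) * (β * ‖d.1‖ ^ 2 - d.1.re) * (1 - 4 * θ) +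
      θ * (4 * (1 - β) * ((1 - 2 * β * conj d.1) * d.2.1).re +
        2 * ‖1 - (2 * β - 1) * d.1‖ ^ 2) ≤ C₂ * θ ^ 2) ∧
    ‖d.2.2.1‖ ≤ (conj d.1 * (1 - d.2.1 - d.1)).re + b * (‖d.1‖ ^ 2 + d.2.2.2) ∧
    ‖1 - d.2.1 - d.1‖ ^ 2 ≤ C₃ * (‖d.1‖ ^ 2 + d.2.2.2) ∧ ‖d‖ ≤ K}

/-- For each fixed `θ` the conditions are non-strict inequalities between continuous functions, so
they pass to limits. Contact conditions stated as equations would make sense only at a contact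
point. -/
theorem isCompact_firstOrderData (β b C₁ δ₁ C₂ δ₂ C₃ K : ℝ) :
    IsCompact (firstOrderData β b C₁ δ₁ C₂ δ₂ C₃ K) := by
  refine (isCompact_closedBall (0 : ℂ × ℂ × ℂ × ℝ) K).of_isClosed_subset ?_ fun d hd => by
    rw [mem_closedBall_zero_iff]
    exact hd.2.2.2.2.2.2.2.2
  have := Complex.continuous_re
  have := Complex.continuous_im
  have := Complex.continuous_conj
  simp only [firstOrderData, ofPred_and, ofPred_forall]
  refine IsClosed.inter ?_ <| IsClosed.inter ?_ <| IsClosed.inter ?_ <| IsClosed.inter ?_ <|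
    IsClosed.inter ?_ <| IsClosed.inter ?_ <| IsClosed.inter ?_ <| IsClosed.inter ?_ ?_
  · exact isClosed_le (by fun_prop) (by fun_prop)
  · exact isClosed_le (by fun_prop) (by fun_prop)
  · exact isClosed_iInter fun θ => isClosed_iInter fun _ => isClosed_le (by fun_prop) (by fun_prop)
  · exact isClosed_iInter fun θ => isClosed_iInter fun _ => isClosed_le (by fun_prop) (by fun_prop)
  · exact isClosed_iInter fun θ => isClosed_iInter fun _ => isClosed_le (by fun_prop) (by fun_prop)
  · exact isClosed_iInter fun θ => isClosed_iInter fun _ => isClosed_le (by fun_prop) (by fun_prop)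
  · exact isClosed_le (by fun_prop) (by fun_prop)
  · exact isClosed_le (by fun_prop) (by fun_prop)
  · exact isClosed_le (by fun_prop) (by fun_prop)

/-- If the form vanished, dividing the inequalities by `θ` and letting `θ → 0` would recover the
exact contact conditions, excluded by `jack_algebra`. -/
theorem firstOrderData_neg {α β b C₁ δ₁ C₂ δ₂ C₃ K : ℝ} (hα : 0 ≤ α) (hβ : 1 / 2 ≤ β)
    (hβ1 : β < 1) (hαβ : 2 * β ^ 2 - (2 * α - 1) * β - 1 = 0) (hb : b < 1 - α) (hδ₁ : 0 < δ₁)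
    (hδ₂ : 0 < δ₂) {d : ℂ × ℂ × ℂ × ℝ} (hd : d ∈ firstOrderData β b C₁ δ₁ C₂ δ₂ C₃ K) :
    β * ‖d.1‖ ^ 2 - d.1.re < 0 := by
  obtain ⟨hσ, h1, h2, h3, h4, h5, h6, h7, -⟩ := hd
  refine lt_of_le_of_ne h1 fun h1 => ?_
  have h2' := abs_nonpos_iff.1 (nonpos_of_add_mul_le_sq hδ₁ h1.ge h2)
  have h3' := abs_nonpos_iff.1 (nonpos_of_add_mul_le_sq hδ₁ h1.ge h3)
  have h4' := abs_nonpos_iff.1 (nonpos_of_add_mul_le_sq hδ₁ h1.ge h4)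
  have h5' := nonpos_of_add_mul_le_sq (g := 0) hδ₂ le_rfl fun θ hθ => by
    have := h5 θ hθ
    rwa [h1, mul_zero, zero_mul] at this
  exact jack_algebra hα hβ hβ1 hαβ hb hσ (by linarith) h2' (by linarith) h3' h4' h6 h7

theorem exists_firstOrderData_le {α β b C₁ δ₁ C₂ δ₂ C₃ K : ℝ} (hα : 0 ≤ α) (hβ : 1 / 2 ≤ β)
    (hβ1 : β < 1) (hαβ : 2 * β ^ 2 - (2 * α - 1) * β - 1 = 0) (hb : b < 1 - α) (hδ₁ : 0 < δ₁)
    (hδ₂ : 0 < δ₂) : ∃ ε > 0, ∀ d ∈ firstOrderData β b C₁ δ₁ C₂ δ₂ C₃ K,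
      β * ‖d.1‖ ^ 2 - d.1.re ≤ -ε := by
  rcases (firstOrderData β b C₁ δ₁ C₂ δ₂ C₃ K).eq_empty_or_nonempty with he | hne
  · exact ⟨1, one_pos, fun d hd => by rw [he] at hd; exact hd.elim⟩
  have := Complex.continuous_re
  obtain ⟨d₀, hd₀, hmax⟩ := (isCompact_firstOrderData β b C₁ δ₁ C₂ δ₂ C₃ K).exists_isMaxOn hne
    (f := fun d => β * ‖d.1‖ ^ 2 - d.1.re) (Continuous.continuousOn (by fun_prop))
  exact ⟨-(β * ‖d₀.1‖ ^ 2 - d₀.1.re),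
    neg_pos.2 (firstOrderData_neg hα hβ hβ1 hαβ hb hδ₁ hδ₂ hd₀), fun d hd => by
      rw [neg_neg]; exact hmax hd⟩

end Admissible

/-! ### Strict inequality on spheres and the continuity argument in the radius. -/

namespace IsConvexOfOrder

variable {X : Type*} [NormedAddCommGroup X] [InnerProductSpace ℂ X] [CompleteSpace X]
  {f : X → X} {α : ℝ}

open ComplexConjugate in
theorem exists_firstOrderData (hf : IsConvexOfOrder α f) (hα : α < 1) (h0 : f 0 = 0) {β r : ℝ}
    (hβ : β < 1) (hr0 : 0 < r) (hr1 : r < 1)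
    (hF : ∀ z, ‖z‖ ≤ r → starForm β (radialField f) z ≤ 0) :
    ∃ C₁ δ₁ C₂ δ₂ C₃ K : ℝ, 0 < δ₁ ∧ 0 < δ₂ ∧ ∀ z : X, ‖z‖ = r → ∃ d ∈ firstOrderData β
      ((1 - α) * (2 * r / (1 + r))) C₁ δ₁ C₂ δ₂ C₃ K,
      d.1 = inner ℂ z (radialField f z) / (r : ℂ) ^ 2 := by
  obtain ⟨L, hL, _, _, _, HL⟩ := hf.exists_radialField_taylor hα h0 hr1
  -- `L + 1` bounds the lengths of the three test directions `iz`, `v` and `iv`.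
  obtain ⟨C₁, δ₁, hδ₁, H₁⟩ := hf.exists_tangential_bound hα h0 hr0 hr1 hF
    (M := L + 1) (by linarith)
  obtain ⟨C₂, δ₂, hδ₂, H₂⟩ := hf.exists_radial_bound hα h0 hβ hr0 hr1 hF
  obtain ⟨C, hC, HC⟩ := hf.exists_norm_preSchwarzian_le hα hr1
  refine ⟨C₁, δ₁, C₂, δ₂, C ^ 2 * r ^ 2, 2 * L / r ^ 2 + L ^ 2 / r ^ 2, hδ₁, hδ₂, fun z hz => ?_⟩
  obtain ⟨hwL, hDL, -⟩ := HL z hz.le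
  have hzb : z ∈ ball (0 : X) 1 := mem_ball_zero_iff.2 (by rw [hz]; exact hr1)
  have hDw := hf.1.fderiv_radialField hzb
  have hTs := hf.1.preSchwarzian_comm hzb
  have hTC := HC z hz.le
  have hTre := fun x => hf.re_inner_preSchwarzian_le hα hr1 hz.le (x := x)
  have H₁' := H₁ z hz
  have H₂' := H₂ z hz
  clear HL H₁ H₂ HC
  set w := radialField f
  set T := preSchwarzian f z
  set p := inner ℂ z (w z) / (r : ℂ) ^ 2 with hp
  set v := w z - p • z with hv
  set D := inner ℂ z (fderiv ℂ w z z) / (r : ℂ) ^ 2 - p with hD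
  set A := inner ℂ z (fderiv ℂ w z v) / (r : ℂ) ^ 2 with hA
  set σ := ‖v‖ ^ 2 / r ^ 2 with hσ
  have hrc : (r : ℂ) ≠ 0 := by exact_mod_cast hr0.ne'
  have hr2 : ‖(r : ℂ) ^ 2‖ = r ^ 2 := by rw [norm_pow, Complex.norm_real, Real.norm_of_nonneg hr0.le]
  have hzz : inner ℂ z z = (r : ℂ) ^ 2 := by rw [inner_self_eq_norm_sq_to_K, hz]; simp
  have hpz : inner ℂ z (w z) = p * (r : ℂ) ^ 2 := by rw [hp]; field_simp
  have hzv : inner ℂ z v = 0 := by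
    rw [hv, inner_sub_right, inner_smul_right, hzz, hpz, sub_self]
  have hvz : inner ℂ v z = 0 := by rw [← inner_conj_symm, hzv, map_zero]
  have hw : w z = p • z + v := by rw [hv]; abel
  have hpyth : ‖w z‖ ^ 2 = r ^ 2 * (‖p‖ ^ 2 + σ) := by
    rw [hw, @norm_add_sq ℂ, inner_smul_left, hzv, mul_zero, map_zero, norm_smul, hz, hσ]
    field_simp
    ring
  have hvw : inner ℂ v (w z) = (r : ℂ) ^ 2 * σ := by
    rw [hw, inner_add_right, inner_smul_right, hvz, inner_self_eq_norm_sq_to_K, hσ]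
    push_cast
    simp only [Complex.coe_algebraMap]
    field_simp
    ring
  have hσ0 : 0 ≤ σ := by positivity
  have hvL : ‖v‖ ≤ L := by
    have h1 : ‖v‖ ^ 2 ≤ ‖w z‖ ^ 2 := by
      have : r ^ 2 * σ = ‖v‖ ^ 2 := by rw [hσ]; field_simp
      rw [hpyth, mul_add, this]
      have : 0 ≤ r ^ 2 * ‖p‖ ^ 2 := by positivity
      linarith
    exact ((sq_le_sq₀ (norm_nonneg _) (norm_nonneg _)).1 h1).trans hwL
  have hDz : inner ℂ z (fderiv ℂ w z z) = (D + p) * (r : ℂ) ^ 2 := by rw [hD]; field_simp; ring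
  have hDv : inner ℂ z (fderiv ℂ w z v) = A * (r : ℂ) ^ 2 := by rw [hA]; field_simp
  have hTz : inner ℂ z (T (w z) z) = (r : ℂ) ^ 2 * (1 - D - p) := by
    have := hDz
    rw [hDw, inner_sub_right, hzz] at this
    linear_combination -this
  have hTv : inner ℂ z (T (w z) v) = -(r : ℂ) ^ 2 * A := by
    have := hDv
    rw [hDw, inner_sub_right, hzv] at this
    linear_combination -this
  -- Both `y` and `-y` are tangential, hence the absolute value.
  have hI : ∀ y, (inner ℂ z y).re = 0 → ‖y‖ ≤ L + 1 → ∀ q : ℂ,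
      inner ℂ z (fderiv ℂ w z y) + inner ℂ y (w z) = (r : ℂ) ^ 2 * q → ∀ θ ∈ Ioo 0 δ₁,
      β * ‖p‖ ^ 2 - p.re + θ * |((1 - 2 * β * conj p) * q).re| ≤ C₁ * θ ^ 2 := by
    intro y hy hyn q hq θ hθ
    have h1 := H₁' y hy hyn θ hθ
    have h2 := H₁' (-y) (by simpa using hy) (by simpa using hyn) θ hθ
    rw [hq, mul_div_cancel_left₀ _ (pow_ne_zero 2 hrc)] at h1
    have hq' : inner ℂ z (fderiv ℂ w z (-y)) + inner ℂ (-y) (w z) = (r : ℂ) ^ 2 * (-q) := by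
      rw [map_neg, inner_neg_right, inner_neg_left, ← neg_add, hq]; ring
    rw [hq', mul_div_cancel_left₀ _ (pow_ne_zero 2 hrc), mul_neg, Complex.neg_re] at h2
    rcases abs_cases ((1 - 2 * β * conj p) * q).re with ⟨h, _⟩ | ⟨h, _⟩ <;> rw [h] <;> linarith
  refine ⟨(p, D, A, σ), ⟨hσ0, ?_, fun θ hθ => ?_, fun θ hθ => ?_, fun θ hθ => ?_, fun θ hθ => ?_,
    ?_, ?_, ?_⟩, rfl⟩
  · have h1 := hF z hz.le
    rw [starForm, hpz, hz] at h1
    rw [show p * (r : ℂ) ^ 2 = ((r ^ 2 : ℝ) : ℂ) * p by push_cast; ring, norm_mul,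
      Complex.re_ofReal_mul, Complex.norm_real, Real.norm_of_nonneg (by positivity)] at h1
    have hr4 : 0 < r ^ 2 * r ^ 2 := by positivity
    refine le_of_mul_le_mul_left ?_ hr4
    rw [mul_zero]
    refine le_trans (le_of_eq ?_) h1
    ring
  · have h1 := hI (Complex.I • z) (by rw [inner_smul_right, hzz, ← Complex.ofReal_pow, mul_comm,
        Complex.re_ofReal_mul, Complex.I_re, mul_zero])
      (by rw [norm_smul, Complex.norm_I, one_mul, hz]; linarith) (Complex.I * D) (by
        rw [map_smul, inner_smul_right, inner_smul_left, hDz, hpz]; simp; ring) θ hθ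
    have e : ((1 - 2 * β * conj p) * (Complex.I * D)).re = -((1 - 2 * β * conj p) * D).im := by
      rw [mul_left_comm, Complex.I_mul_re]
    rwa [e, abs_neg] at h1
  · exact hI v (by rw [hzv]; simp) (by linarith) (A + σ) (by rw [hDv, hvw]; ring) θ hθ
  · have h1 := hI (Complex.I • v) (by rw [inner_smul_right, hzv]; simp)
      (by rw [norm_smul, Complex.norm_I, one_mul]; linarith) (Complex.I * (A - σ)) (by
        rw [map_smul, inner_smul_right, inner_smul_left, hDv, hvw]; simp; ring) θ hθ
    have e : ((1 - 2 * β * conj p) * (Complex.I * (A - σ))).re =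
        -((1 - 2 * β * conj p) * (A - σ)).im := by
      rw [mul_left_comm, Complex.I_mul_re]
    rwa [e, abs_neg] at h1
  · exact H₂' θ hθ p D hp hD
  · have h1 := norm_inner_bilin_le T hTs (p := p) hzv hTre
    rw [← hw, hTz, hTv, norm_mul, norm_neg, hr2, hz] at h1
    have e : (conj p * ((r : ℂ) ^ 2 * (1 - D - p))).re = r ^ 2 * (conj p * (1 - D - p)).re := by
      rw [mul_left_comm, ← Complex.ofReal_pow, Complex.re_ofReal_mul]
    have hv2 : ‖v‖ ^ 2 = r ^ 2 * σ := by rw [hσ]; field_simp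
    rw [e, hv2] at h1
    refine le_of_mul_le_mul_left ?_ (by positivity : 0 < r ^ 2)
    linarith
  · have h1 := (norm_inner_le_norm (𝕜 := ℂ) z (T (w z) z)).trans
      (mul_le_mul_of_nonneg_left (hTC (w z) z) (norm_nonneg z))
    rw [hTz, norm_mul, hr2, hz] at h1
    have h2 : ‖1 - D - p‖ ≤ C * ‖w z‖ := by
      refine le_of_mul_le_mul_left ?_ (by positivity : 0 < r ^ 2)
      linarith
    calc ‖1 - D - p‖ ^ 2 ≤ (C * ‖w z‖) ^ 2 := by gcongr
      _ = C ^ 2 * r ^ 2 * (‖p‖ ^ 2 + σ) := by rw [mul_pow, hpyth]; ring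
  · have hr1' : 0 ≤ L ^ 2 / r ^ 2 := by positivity
    have hL1 : 0 ≤ L / r ^ 2 := by positivity
    have e2 : 2 * L / r ^ 2 = L / r ^ 2 + L / r ^ 2 := by ring
    have hpn : ‖p‖ ≤ L / r ^ 2 := by
      rw [hp, norm_div, hr2]
      gcongr
      refine (norm_inner_le_norm _ _).trans ?_
      rw [hz]
      exact (mul_le_of_le_one_left (norm_nonneg _) hr1.le).trans hwL
    have hin : ∀ y, ‖inner ℂ z (fderiv ℂ w z y)‖ ≤ L * ‖y‖ := by
      intro y
      refine (norm_inner_le_norm _ _).trans ?_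
      rw [hz]
      exact (mul_le_of_le_one_left (norm_nonneg _) hr1.le).trans
        ((fderiv ℂ w z).le_of_opNorm_le hDL y)
    have hDn : ‖D‖ ≤ L / r ^ 2 + L / r ^ 2 := by
      rw [hD]
      refine (norm_sub_le _ _).trans (add_le_add ?_ hpn)
      rw [norm_div, hr2]
      gcongr
      refine (hin z).trans ?_
      rw [hz]
      exact mul_le_of_le_one_right hL hr1.le
    have hAn : ‖A‖ ≤ L ^ 2 / r ^ 2 := by
      rw [hA, norm_div, hr2, sq L]
      gcongr
      exact (hin v).trans (by gcongr)
    have hσn : ‖σ‖ ≤ L ^ 2 / r ^ 2 := by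
      rw [Real.norm_of_nonneg hσ0, hσ]; gcongr
    simp only [Prod.norm_def, sup_le_iff]
    exact ⟨by linarith, by linarith, by linarith, by linarith⟩

theorem exists_starForm_le_neg_on_sphere (hf : IsConvexOfOrder α f) (hα0 : 0 ≤ α) (hα : α < 1)
    (h0 : f 0 = 0) {β r : ℝ} (hβ : 1 / 2 ≤ β) (hβ1 : β < 1)
    (hαβ : 2 * β ^ 2 - (2 * α - 1) * β - 1 = 0) (hr0 : 0 < r) (hr1 : r < 1)
    (hF : ∀ z, ‖z‖ ≤ r → starForm β (radialField f) z ≤ 0) :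
    ∃ ε > 0, ∀ z : X, ‖z‖ = r → starForm β (radialField f) z ≤ -ε := by
  obtain ⟨C₁, δ₁, C₂, δ₂, C₃, K, hδ₁, hδ₂, H⟩ := hf.exists_firstOrderData hα h0 hβ1 hr0 hr1 hF
  have hb : (1 - α) * (2 * r / (1 + r)) < 1 - α := by
    have : 2 * r / (1 + r) < 1 := by rw [div_lt_one (by linarith)]; linarith
    nlinarith
  obtain ⟨ε, hε, hle⟩ := exists_firstOrderData_le (C₁ := C₁) (C₂ := C₂) (C₃ := C₃) (K := K)
    hα0 hβ hβ1 hαβ hb hδ₁ hδ₂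
  refine ⟨r ^ 2 * r ^ 2 * ε, by positivity, fun z hz => ?_⟩
  obtain ⟨d, hd, hdp⟩ := H z hz
  have h1 := hle d hd
  have hrc : (r : ℂ) ≠ 0 := by exact_mod_cast hr0.ne'
  have e : inner ℂ z (radialField f z) = ((r ^ 2 : ℝ) : ℂ) * d.1 := by
    rw [hdp]; push_cast; field_simp
  rw [starForm, e, hz, norm_mul, Complex.re_ofReal_mul, Complex.norm_real,
    Real.norm_of_nonneg (by positivity)]
  have hr4 : 0 < r ^ 2 * r ^ 2 := by positivity
  have := mul_le_mul_of_nonneg_left h1 hr4.le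
  refine le_trans (le_of_eq ?_) (this.trans_eq ?_) <;> ring

end IsConvexOfOrder

theorem exists_starForm_nonpos_near_zero {X : Type*} [NormedAddCommGroup X]
    [InnerProductSpace ℂ X] {w : X → X} {β : ℝ} (hβ0 : 0 ≤ β) (hβ : β < 1)
    (hw : HasFDerivAt w (ContinuousLinearMap.id ℂ X) 0) (hw0 : w 0 = 0) :
    ∃ r > 0, ∀ z : X, ‖z‖ < r → starForm β w z ≤ 0 := by
  -- With this choice `β = 1 - 4η`, and `(1 - 4η)(1 + η)² ≤ 1 - η` as required at the end.
  set η := (1 - β) / 4 with hη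
  have hηpos : 0 < η := by rw [hη]; linarith
  have h1 := hw.isLittleO.bound hηpos
  obtain ⟨r, hr, H⟩ := Metric.eventually_nhds_iff_ball.1 h1
  refine ⟨r, hr, fun z hz => ?_⟩
  have h2 := H z (mem_ball_zero_iff.2 hz)
  simp only [hw0, sub_zero, ContinuousLinearMap.id_apply] at h2
  set q := inner ℂ z (w z - z) with hq
  have hqn : ‖q‖ ≤ η * ‖z‖ ^ 2 := by
    refine (norm_inner_le_norm _ _).trans ?_
    calc ‖z‖ * ‖w z - z‖ ≤ ‖z‖ * (η * ‖z‖) := by gcongr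
      _ = _ := by ring
  have hP : inner ℂ z (w z) = ((‖z‖ ^ 2 : ℝ) : ℂ) + q := by
    rw [hq, inner_sub_right, inner_self_eq_norm_sq_to_K]; simp
  have hPn : ‖inner ℂ z (w z)‖ ≤ (1 + η) * ‖z‖ ^ 2 := by
    rw [hP]
    refine (norm_add_le _ _).trans ?_
    rw [Complex.norm_real, Real.norm_of_nonneg (by positivity)]
    linarith
  have hPre : (1 - η) * ‖z‖ ^ 2 ≤ (inner ℂ z (w z)).re := by
    rw [hP, Complex.add_re, Complex.ofReal_re]
    linarith [neg_le_of_abs_le ((Complex.abs_re_le_norm q).trans hqn)]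
  have h3 : ‖inner ℂ z (w z)‖ ^ 2 ≤ ((1 + η) * ‖z‖ ^ 2) ^ 2 := by gcongr
  have h4 : β * (1 + η) ^ 2 ≤ 1 - η := by
    have : β = 1 - 4 * η := by rw [hη]; ring
    rw [this]
    nlinarith [pow_pos hηpos 3]
  have hs := sq_nonneg ‖z‖
  rw [starForm]
  have h5 : β * ‖inner ℂ z (w z)‖ ^ 2 ≤ β * ((1 + η) * ‖z‖ ^ 2) ^ 2 := by gcongr
  have h6 : ‖z‖ ^ 2 * ((1 - η) * ‖z‖ ^ 2) ≤ ‖z‖ ^ 2 * (inner ℂ z (w z)).re := by gcongr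
  have h7 : β * (1 + η) ^ 2 * (‖z‖ ^ 2 * ‖z‖ ^ 2) ≤ (1 - η) * (‖z‖ ^ 2 * ‖z‖ ^ 2) := by gcongr
  linarith

theorem starForm_nonpos_of_norm_le {X : Type*} [NormedAddCommGroup X] [InnerProductSpace ℂ X]
    {w : X → X} {β r : ℝ} (hr0 : 0 < r) (hw : ∀ z, ‖z‖ ≤ r → ContinuousAt w z)
    (h : ∀ z, ‖z‖ < r → starForm β w z ≤ 0) (z : X) (hz : ‖z‖ ≤ r) : starForm β w z ≤ 0 := by
  have hc : ContinuousAt (starForm β w) z := by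
    have := hw z hz
    unfold starForm
    have h2 : ContinuousAt (fun z => inner ℂ z (w z)) z := ContinuousAt.inner (𝕜 := ℂ) continuousAt_id this
    exact (continuousAt_const.mul (h2.norm.pow 2)).sub ((continuousAt_id.norm.pow 2).mul
      (Complex.continuous_re.continuousAt.comp h2))
  have hmem : z ∈ closure (ball (0 : X) r) := by
    rw [closure_ball _ hr0.ne']; simpa using hz
  have := mem_closure_iff_nhdsWithin_neBot.1 hmem
  refine le_of_tendsto (hc.mono_left nhdsWithin_le_nhds : Tendsto _ (𝓝[ball 0 r] z) _) ?_
  filter_upwards [self_mem_nhdsWithin] with y hy using h y (mem_ball_zero_iff.1 hy)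

/-- The gap `ε` survives a move of size `η`: the changes in `|P|²`, in `n²` and in `Re P` cost at
most `15L²η`, `8Lη` and `3Lη`. -/
theorem sub_mul_re_nonpos_of_near {β r ε L η n : ℝ} {P P' : ℂ} (hβ0 : 0 ≤ β) (hβ1 : β < 1)
    (hr0 : 0 < r) (hr1 : r < 1) (hL : 0 ≤ L) (hη : 0 ≤ η) (hη1 : η ≤ 1) (hrη : r + η ≤ 1)
    (hn : r ≤ n) (hnη : n ≤ r + η) (hP' : ‖P'‖ ≤ L) (hPP : ‖P - P'‖ ≤ 3 * L * η)
    (h : β * ‖P'‖ ^ 2 - r ^ 2 * P'.re ≤ -ε) (hC : (15 * L ^ 2 + 11 * L) * η ≤ ε) :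
    β * ‖P‖ ^ 2 - n ^ 2 * P.re ≤ 0 := by
  have hLη : L * η ≤ L := mul_le_of_le_one_right hL hη1
  have hLη0 : 0 ≤ L * η := mul_nonneg hL hη
  have hPn : ‖P‖ ≤ 4 * L := by
    have := norm_sub_norm_le P P'
    linarith
  have f2 : β * (‖P‖ ^ 2 - ‖P'‖ ^ 2) ≤ 15 * L ^ 2 * η := by
    have h1 : ‖P‖ - ‖P'‖ ≤ 3 * L * η := (norm_sub_norm_le P P').trans hPP
    have h2 : (‖P‖ - ‖P'‖) * (‖P‖ + ‖P'‖) ≤ 3 * L * η * (5 * L) :=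
      mul_le_mul h1 (by linarith) (by positivity) (by positivity)
    have h3 : β * ((‖P‖ - ‖P'‖) * (‖P‖ + ‖P'‖)) ≤ β * (3 * L * η * (5 * L)) := by gcongr
    have h4 : β * (3 * L * η * (5 * L)) ≤ 3 * L * η * (5 * L) :=
      mul_le_of_le_one_left (by positivity) hβ1.le
    linarith
  have f3 : -((n ^ 2 - r ^ 2) * P.re) ≤ 8 * L * η := by
    have h1 : -P.re ≤ 4 * L := by linarith [neg_le_of_abs_le (Complex.abs_re_le_norm P)]
    have h2 : 0 ≤ n ^ 2 - r ^ 2 := by nlinarith only [hn, hr0]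
    have h3 : n ^ 2 - r ^ 2 ≤ 2 * η := by
      have : (n - r) * (n + r) ≤ η * 2 :=
        mul_le_mul (by linarith) (by linarith) (by linarith) hη
      linarith
    have h4 : (n ^ 2 - r ^ 2) * (-P.re) ≤ (n ^ 2 - r ^ 2) * (4 * L) := by gcongr
    have h5 : (n ^ 2 - r ^ 2) * (4 * L) ≤ 2 * η * (4 * L) := by gcongr
    linarith
  have f4 : -(r ^ 2 * (P - P').re) ≤ 3 * L * η := by
    have h1 := neg_le_of_abs_le ((Complex.abs_re_le_norm (P - P')).trans hPP)
    have h2 : r ^ 2 ≤ 1 := pow_le_one₀ hr0.le hr1.le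
    have h3 : r ^ 2 * (-(P - P').re) ≤ r ^ 2 * (3 * L * η) := by
      gcongr; linarith
    have h4 : r ^ 2 * (3 * L * η) ≤ 3 * L * η := mul_le_of_le_one_left (by linarith) h2
    linarith
  rw [Complex.sub_re] at f4
  linarith

namespace IsConvexOfOrder

variable {X : Type*} [NormedAddCommGroup X] [InnerProductSpace ℂ X] [CompleteSpace X]
  {f : X → X} {α : ℝ}

theorem exists_starForm_nonpos_of_neg_on_sphere (hf : IsConvexOfOrder α f) (hα : α < 1)
    (h0 : f 0 = 0) {β r ε : ℝ} (hβ0 : 0 ≤ β) (hβ1 : β < 1) (hr0 : 0 < r) (hr1 : r < 1)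
    (hε : 0 < ε) (hF : ∀ z, ‖z‖ < r → starForm β (radialField f) z ≤ 0)
    (hS : ∀ z, ‖z‖ = r → starForm β (radialField f) z ≤ -ε) :
    ∃ η > 0, ∀ z, ‖z‖ < r + η → starForm β (radialField f) z ≤ 0 := by
  obtain ⟨L, hL, δ, hδ, H⟩ := hf.exists_inner_radialField_taylor hα h0 hr1
  set w := radialField f
  set C := 15 * L ^ 2 + 11 * L + 1 with hC
  have hCpos : 0 < C := by positivity
  set η := min (min δ (1 - r)) (ε / C) with hη
  have hηpos : 0 < η := lt_min (lt_min hδ (by linarith)) (by positivity)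
  have hη1 : η ≤ δ := (min_le_left _ _).trans (min_le_left _ _)
  have hη2 : η ≤ 1 - r := (min_le_left _ _).trans (min_le_right _ _)
  have hη3 : C * η ≤ ε := by
    have : η ≤ ε / C := min_le_right _ _
    rw [le_div_iff₀ hCpos] at this
    linarith
  refine ⟨η, hηpos, fun z hz => ?_⟩
  rcases lt_or_ge ‖z‖ r with hzr | hzr
  · exact hF z hzr
  have hzpos : 0 < ‖z‖ := hr0.trans_le hzr
  set z' : X := ((r / ‖z‖ : ℝ) : ℂ) • z with hz'
  have hz'n : ‖z'‖ = r := by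
    rw [hz', norm_smul, Complex.norm_real, Real.norm_of_nonneg (by positivity),
      div_mul_cancel₀ _ hzpos.ne']
  set h : X := ((1 - r / ‖z‖ : ℝ) : ℂ) • z with hh
  have hzh : z' + h = z := by rw [hz', hh]; push_cast; module
  have hhn : ‖h‖ = ‖z‖ - r := by
    rw [hh, norm_smul, Complex.norm_real, Real.norm_of_nonneg]
    · field_simp
    · rw [sub_nonneg, div_le_one hzpos]; exact hzr
  obtain ⟨b1, b2, b3⟩ := H z' hz'n.le
  have hb := b3 h (by rw [hhn]; linarith)
  rw [hzh] at hb
  set P := inner ℂ z (w z)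
  set P' := inner ℂ z' (w z')
  have hS' := hS z' hz'n
  rw [starForm, hz'n] at hS'
  rw [starForm]
  have hhη : ‖h‖ ≤ η := by rw [hhn]; linarith
  have hη1' : η ≤ 1 := by linarith
  have hP' : ‖P'‖ ≤ L := by
    refine (norm_inner_le_norm _ _).trans ?_
    rw [hz'n]
    exact (mul_le_of_le_one_left (norm_nonneg _) hr1.le).trans b1
  have hPP : ‖P - P'‖ ≤ 3 * L * η := by
    have e1 : ‖inner ℂ z' (fderiv ℂ w z' h)‖ ≤ L * η := by
      refine (norm_inner_le_norm _ _).trans ?_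
      rw [hz'n]
      exact (mul_le_of_le_one_left (norm_nonneg _) hr1.le).trans
        (((fderiv ℂ w z').le_of_opNorm_le b2 h).trans (by gcongr))
    have e2 : ‖inner ℂ h (w z')‖ ≤ L * η := by
      refine (norm_inner_le_norm _ _).trans ?_
      rw [mul_comm]; gcongr
    have e3 : L * ‖h‖ ^ 2 ≤ L * η := by
      gcongr
      calc ‖h‖ ^ 2 ≤ η ^ 2 := by gcongr
        _ ≤ η := by nlinarith
    have e4 : P - P' = (P - P' - (inner ℂ z' (fderiv ℂ w z' h) + inner ℂ h (w z'))) +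
        (inner ℂ z' (fderiv ℂ w z' h) + inner ℂ h (w z')) := by ring
    rw [e4]
    refine (norm_add_le _ _).trans ?_
    linarith [norm_add_le (inner ℂ z' (fderiv ℂ w z' h)) (inner ℂ h (w z'))]
  exact sub_mul_re_nonpos_of_near hβ0 hβ1 hr0 hr1 hL hηpos.le hη1' (by linarith)
    hzr hz.le hP' hPP hS' (by rw [hC] at hη3; linarith)

/-- A convex mapping of order `α` is starlike of order `β`. -/
theorem starForm_nonpos (hf : IsConvexOfOrder α f) (hα0 : 0 ≤ α) (hα : α < 1)
    (h0 : f 0 = 0) {β : ℝ} (hβ : 1 / 2 ≤ β) (hβ1 : β < 1)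
    (hαβ : 2 * β ^ 2 - (2 * α - 1) * β - 1 = 0) {z : X} (hz : z ∈ ball (0 : X) 1) :
    starForm β (radialField f) z ≤ 0 := by
  rw [mem_ball_zero_iff] at hz
  have hwd : ∀ y : X, ‖y‖ < 1 → DifferentiableAt ℂ (radialField f) y := fun y hy =>
    hf.1.differentiableOn_radialField.differentiableAt
      (isOpen_ball.mem_nhds (mem_ball_zero_iff.2 hy))
  obtain ⟨r₀, hr₀, H₀⟩ := exists_starForm_nonpos_near_zero (w := radialField f) (by linarith) hβ1
    (by
      have := (hwd 0 (by simp)).hasFDerivAt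
      rwa [hf.fderiv_radialField_zero h0] at this) (radialField_zero h0)
  set ρ := (1 + ‖z‖) / 2 with hρ
  have hρ1 : ρ < 1 := by rw [hρ]; linarith
  have hρz : ‖z‖ < ρ := by rw [hρ]; linarith
  have hρ0 : 0 < ρ := (norm_nonneg z).trans_lt hρz
  -- The admissible radii form a closed set, and the uniform gap on spheres lets every admissible
  -- radius in the interval be increased; hence all of `[min r₀ ρ, ρ]` is admissible.
  set s : Set ℝ := {r | ∀ y : X, ‖y‖ < r → starForm β (radialField f) y ≤ 0} with hs
  have hcl : IsClosed s := by
    have : s = ⋂ y : X, {r | ‖y‖ < r → starForm β (radialField f) y ≤ 0} := by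
      rw [hs, ofPred_forall]
    rw [this]
    refine isClosed_iInter fun y => ?_
    by_cases hy : starForm β (radialField f) y ≤ 0
    · simp [hy]
    · simp only [hy, imp_false, not_lt]
      exact isClosed_Iic
  have hsub : Icc (min r₀ ρ) ρ ⊆ s := by
    refine (hcl.inter isClosed_Icc).Icc_subset_of_forall_exists_gt
      (fun y hy => H₀ y (hy.trans_le (min_le_left _ _))) ?_
    rintro r ⟨hrs, hr⟩ y hy
    have hrpos : 0 < r := (lt_min hr₀ hρ0).trans_le hr.1
    have hr1 : r < 1 := hr.2.trans hρ1
    have hclosed := starForm_nonpos_of_norm_le hrpos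
      (fun y hy => (hwd y (hy.trans_lt hr1)).continuousAt) hrs
    obtain ⟨ε, hε, hS⟩ := hf.exists_starForm_le_neg_on_sphere hα0 hα h0 hβ hβ1 hαβ hrpos hr1 hclosed
    obtain ⟨η, hη, hη'⟩ := hf.exists_starForm_nonpos_of_neg_on_sphere hα h0 (by linarith) hβ1 hrpos
      hr1 hε hrs hS
    exact ⟨min y (r + η), fun x hx => hη' x (hx.trans_le (min_le_right _ _)),
      lt_min hy (by linarith), min_le_left _ _⟩
  exact hsub ⟨min_le_right _ _, le_rfl⟩ z hρz

end IsConvexOfOrder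

/-! ### Flows of the radial field. -/

theorem exists_mem_closedBall_of_isPicardLindelof {E : Type*} [NormedAddCommGroup E]
    [NormedSpace ℝ E] [CompleteSpace E] {f : ℝ → E → E} {tmin tmax : ℝ}
    {t₀ : Icc tmin tmax} {x : E} {a L K : NNReal} (hf : IsPicardLindelof f t₀ x a 0 L K) :
    ∃ γ : ℝ → E, γ t₀ = x ∧ (∀ t, γ t ∈ closedBall x a) ∧
      ∀ t ∈ Icc tmin tmax, HasDerivWithinAt γ (f t (γ t)) (Icc tmin tmax) t := by
  have hx : x ∈ closedBall x ((0 : NNReal) : ℝ) := mem_closedBall_self le_rfl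
  obtain ⟨γ, hγ⟩ := ODE.FunSpace.exists_isFixedPt_next hf hx
  refine ⟨γ.compProj, by rw [ODE.FunSpace.compProj_val, ← hγ, ODE.FunSpace.next_apply₀],
    fun t => γ.compProj_mem_closedBall hf.mul_max_le, fun t ht ↦ ?_⟩
  apply ODE.hasDerivWithinAt_picard_Icc t₀.2 hf.continuousOn_uncurry
    γ.continuous_compProj.continuousOn (fun _ _ ↦ γ.compProj_mem_closedBall hf.mul_max_le)
    x ht |>.congr_of_mem _ ht
  intro t' ht'
  nth_rw 1 [← hγ]
  rw [ODE.FunSpace.compProj_of_mem ht', ODE.FunSpace.next_apply]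

/-- A holomorphic vector field on the unit ball which is bounded on smaller balls has integral
curves, in both time directions, over a time that is uniform on smaller balls. -/
theorem exists_flow {X : Type*} [NormedAddCommGroup X] [NormedSpace ℂ X] [CompleteSpace X]
    {w : X → X} (hw : DifferentiableOn ℂ w (ball 0 1))
    (hb : ∀ ρ < 1, ∃ K : ℝ, 0 ≤ K ∧ ∀ z, ‖z‖ ≤ ρ → ‖w z‖ ≤ K) {ρ : ℝ} (hρ : ρ < 1) :
    ∃ τ > 0, ∀ z : X, ‖z‖ ≤ ρ → ∀ c : ℝ, |c| ≤ 1 → ∃ γ : ℝ → X, γ 0 = z ∧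
      ∀ t ∈ Icc 0 τ, γ t ∈ ball 0 1 ∧ HasDerivWithinAt γ (c • w (γ t)) (Icc 0 τ) t := by
  obtain ⟨K, hK0, hK⟩ := hb ((1 + ρ) / 2) (by linarith)
  -- Integral curves stay within `ρ + R`, and balls of radius `R` about their points within `ρ + 2R
  -- = (1 + ρ)/2`, where `w` is bounded by `K`; Cauchy's estimate then gives the Lipschitz constant
  -- `2K / R`.
  set R := (1 - ρ) / 4 with hR
  have hRpos : 0 < R := by rw [hR]; linarith
  set τ := R / (K + 1) with hτ
  have hτpos : 0 < τ := by positivity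
  have hτK : K * τ ≤ R := by
    have : τ * (K + 1) = R := by rw [hτ]; field_simp
    nlinarith
  refine ⟨τ, hτpos, fun z hz c hc => ?_⟩
  have hmem : ∀ x ∈ closedBall z R, ‖x‖ ≤ ρ + R := fun x hx => by
    have h1 : ‖x - z‖ ≤ R := by rwa [mem_closedBall_iff_norm] at hx
    have := norm_add_le (x - z) z
    rw [sub_add_cancel] at this
    linarith
  have hsub : ∀ x ∈ closedBall z R, ∀ y ∈ ball x R, ‖y‖ ≤ (1 + ρ) / 2 := fun x hx y hy => by
    have h1 : ‖y - x‖ < R := by rwa [mem_ball_iff_norm] at hy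
    have := norm_add_le (y - x) x
    rw [sub_add_cancel] at this
    have := hmem x hx
    linarith
  have hone : ∀ y : X, ‖y‖ ≤ (1 + ρ) / 2 → y ∈ ball (0 : X) 1 := fun y hy => by
    rw [mem_ball_zero_iff]; linarith
  have hbd : ∀ x ∈ closedBall z R, ‖c • w x‖ ≤ K := fun x hx => by
    rw [norm_smul, Real.norm_eq_abs]
    have := hK x (hsub x hx x (mem_ball_self hRpos))
    nlinarith [norm_nonneg (w x), abs_nonneg c]
  have hlip : LipschitzOnWith (Real.toNNReal (2 * K / R)) (fun x => c • w x)
      (closedBall z R) := by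
    refine LipschitzOnWith.of_dist_le_mul fun x hx y hy => ?_
    have hcx := (convex_closedBall z R)
    have := hcx.norm_image_sub_le_of_norm_hasFDerivWithin_le (𝕜 := ℂ) (f := w)
      (f' := fun x => fderiv ℂ w x) (C := 2 * K / R)
      (fun u hu => ((hw.differentiableAt (isOpen_ball.mem_nhds
        (hone u (hsub u hu u (mem_ball_self hRpos))))).hasFDerivAt.hasFDerivWithinAt))
      (fun u hu => norm_fderiv_le_of_bounded hRpos
        (hw.mono fun v hv => hone v (hsub u hu v hv)) (fun v hv => hK v (hsub u hu v hv))) hy hx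
    rw [dist_eq_norm, dist_eq_norm, ← smul_sub, norm_smul, Real.norm_eq_abs,
      Real.coe_toNNReal _ (by positivity)]
    nlinarith [norm_nonneg (w x - w y), abs_nonneg c]
  have hPL : IsPicardLindelof (fun _ => fun x => c • w x)
      (⟨0, left_mem_Icc.2 hτpos.le⟩ : Icc (0 : ℝ) τ) z ⟨R, hRpos.le⟩ 0 ⟨K, hK0⟩
      (Real.toNNReal (2 * K / R)) := by
    refine IsPicardLindelof.of_time_independent hbd hlip ?_
    have h0 : max (τ - 0) (0 - (0 : ℝ)) = τ := by
      rw [sub_zero, sub_zero]; exact max_eq_left hτpos.le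
    change K * max (τ - 0) (0 - (0 : ℝ)) ≤ R - 0
    rw [h0, sub_zero]; exact hτK
  obtain ⟨γ, hγ0, hγm, hγ⟩ := exists_mem_closedBall_of_isPicardLindelof hPL
  exact ⟨γ, hγ0, fun t ht => ⟨hone _ (hsub _ (hγm t) _ (mem_ball_self hRpos)), hγ t ht⟩⟩

/-- Since `Df(γ) w(γ) = f(γ)`, the curve `e^(-ct) f(γ(t))` has zero derivative. -/
theorem exp_smul_eq_of_flow {X : Type*} [NormedAddCommGroup X] [NormedSpace ℂ X]
    [CompleteSpace X] {f : X → X} (hf : IsLocallyBiholomorphicOn f (ball 0 1)) {c τ : ℝ}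
    (hτ : 0 ≤ τ) {γ : ℝ → X} (hγ : ∀ t ∈ Icc 0 τ, γ t ∈ ball (0 : X) 1 ∧
      HasDerivWithinAt γ (c • radialField f (γ t)) (Icc 0 τ) t) :
    f (γ τ) = Real.exp (c * τ) • f (γ 0) := by
  have hder : ∀ t ∈ Icc 0 τ, HasDerivWithinAt (fun t => Real.exp (-(c * t)) • f (γ t)) 0
      (Icc 0 τ) t := fun t ht => by
    obtain ⟨hm, hd⟩ := hγ t ht
    have hdf := (hf.differentiableOn.differentiableAt (isOpen_ball.mem_nhds hm)).hasFDerivAt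
    have h1 := (hdf.restrictScalars ℝ).comp_hasDerivWithinAt t hd
    have h2 : fderiv ℂ f (γ t) (radialField f (γ t)) = f (γ t) := by
      have hinv := hf.isInvertible_fderiv hm
      obtain ⟨e, he⟩ := hinv
      simp [radialField, ← he]
    have h3 : (fderiv ℂ f (γ t)).restrictScalars ℝ (c • radialField f (γ t)) = c • f (γ t) := by
      rw [map_smul]; exact congrArg _ h2
    rw [h3] at h1
    have h4 : HasDerivWithinAt (fun t => Real.exp (-(c * t))) (Real.exp (-(c * t)) * (-(c * 1)))
        (Icc 0 τ) t := (((hasDerivAt_id t).const_mul c).neg.exp).hasDerivWithinAt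
    convert! h4.smul h1 using 1
    rw [smul_smul, Function.comp_apply, ← add_smul]
    simp
  have hc := constant_of_has_deriv_right_zero (fun t ht => (hder t ht).continuousWithinAt)
    (fun t ht => ((hder t (Ico_subset_Icc_self ht)).mono_of_mem_nhdsWithin
      (Icc_mem_nhdsGE_of_mem ht))) τ (right_mem_Icc.2 hτ)
  simp only [mul_zero, neg_zero, Real.exp_zero, one_smul] at hc
  rw [← hc, smul_smul, ← Real.exp_add]
  simp

/-! ### Growth estimates along the inward flow. -/

theorem betaOrder_spec {α : ℝ} (hα0 : 0 ≤ α) (hα : α < 1) :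
    1 / 2 ≤ betaOrder α ∧ betaOrder α < 1 ∧
      2 * betaOrder α ^ 2 - (2 * α - 1) * betaOrder α - 1 = 0 := by
  have hs := Real.sq_sqrt (show (0 : ℝ) ≤ (2 * α - 1) ^ 2 + 8 by positivity)
  have h0 := Real.sqrt_nonneg ((2 * α - 1) ^ 2 + 8)
  unfold betaOrder
  set s := Real.sqrt ((2 * α - 1) ^ 2 + 8)
  refine ⟨?_, ?_, ?_⟩
  · have : 3 - 2 * α ≤ s := by nlinarith
    linarith
  · have : s < 5 - 2 * α := by nlinarith
    linarith
  · nlinarith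

/-- The hypothesis describes a disc that meets the real axis in `s(1 - r)/(1 - κr)` and `s(1 + r)/(1
+ κr)`; `hprod` says that `Re P` lies between these two points. -/
theorem re_bounds_of_norm_le {P : ℂ} {s r κ : ℝ} (hr0 : 0 ≤ r) (hr : r < 1) (hs : s = r ^ 2)
    (hκ0 : 0 ≤ κ) (hκ : κ < 1) (h : ‖(s : ℂ) - P‖ ≤ r * ‖(s : ℂ) - κ * P‖) :
    s * (1 - r) ≤ (1 - κ * r) * P.re ∧ (1 + κ * r) * P.re ≤ s * (1 + r) := by
  have h2 : ‖(s : ℂ) - P‖ ^ 2 ≤ (r * ‖(s : ℂ) - κ * P‖) ^ 2 := by gcongr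
  rw [mul_pow, Complex.sq_norm, Complex.sq_norm, Complex.normSq_apply, Complex.normSq_apply] at h2
  simp only [Complex.sub_re, Complex.sub_im, Complex.ofReal_re, Complex.ofReal_im, Complex.mul_re,
    Complex.mul_im, zero_mul, sub_zero, add_zero] at h2
  have hs0 : 0 ≤ s := by rw [hs]; positivity
  have hκr : κ * r < 1 := by nlinarith
  have hκr0 : 0 ≤ κ * r := by positivity
  have him : 0 ≤ (1 - (κ * r) ^ 2) * P.im ^ 2 := by
    have : 0 ≤ 1 - (κ * r) ^ 2 := by nlinarith
    positivity
  have hprod : ((1 - κ * r) * P.re - s * (1 - r)) * ((1 + κ * r) * P.re - s * (1 + r)) ≤ 0 := by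
    nlinarith only [h2, him]
  constructor
  · by_contra! hc
    have : (1 + κ * r) * P.re - s * (1 + r) < 0 := by
      have h5 : (1 - κ * r) * ((1 + κ * r) * P.re - s * (1 + r)) < 0 := by
        have h6 : (1 + κ * r) * ((1 - κ * r) * P.re) < (1 + κ * r) * (s * (1 - r)) := by gcongr
        have h7 : (1 + κ * r) * (s * (1 - r)) ≤ (1 - κ * r) * (s * (1 + r)) := by
          have : 0 ≤ s * (r * (1 - κ)) := by
            have : 0 ≤ 1 - κ := by linarith
            positivity
          nlinarith only [this]
        nlinarith only [h6, h7]
      by_contra! h8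
      have : 0 ≤ (1 - κ * r) * ((1 + κ * r) * P.re - s * (1 + r)) :=
        mul_nonneg (by linarith) h8
      linarith
    have := mul_pos_of_neg_of_neg (sub_neg.2 hc) this
    linarith
  · by_contra! hc
    have : 0 < (1 - κ * r) * P.re - s * (1 - r) := by
      have h5 : 0 < (1 + κ * r) * ((1 - κ * r) * P.re - s * (1 - r)) := by
        have h6 : (1 - κ * r) * (s * (1 + r)) < (1 - κ * r) * ((1 + κ * r) * P.re) :=
          mul_lt_mul_of_pos_left hc (by linarith)
        have h7 : (1 + κ * r) * (s * (1 - r)) ≤ (1 - κ * r) * (s * (1 + r)) := by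
          have : 0 ≤ s * (r * (1 - κ)) := by
            have : 0 ≤ 1 - κ := by linarith
            positivity
          nlinarith only [this]
        nlinarith only [h6, h7]
      exact pos_of_mul_pos_right h5 (by linarith)
    have := mul_pos this (sub_pos.2 hc)
    linarith

/-- Two-sided bounds for the real part of the radial field. -/
theorem IsConvexOfOrder.re_inner_radialField_bounds {X : Type*} [NormedAddCommGroup X]
    [InnerProductSpace ℂ X] [CompleteSpace X] {α β : ℝ} {f : X → X} (hf : IsConvexOfOrder α f)
    (hα0 : 0 ≤ α) (hα : α < 1) (h0 : f 0 = 0) (hβ : 1 / 2 ≤ β) (hβ1 : β < 1)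
    (hαβ : 2 * β ^ 2 - (2 * α - 1) * β - 1 = 0) {z : X} (hz : ‖z‖ < 1) :
    ‖z‖ ^ 2 * (1 - ‖z‖) ≤ (1 - (2 * β - 1) * ‖z‖) * (inner ℂ z (radialField f z)).re ∧
      (1 + (2 * β - 1) * ‖z‖) * (inner ℂ z (radialField f z)).re ≤ ‖z‖ ^ 2 * (1 + ‖z‖) := by
  have h := norm_sub_inner_le_of_starForm_nonpos hβ1 hf.1.differentiableOn_radialField
    (radialField_zero h0) (hf.fderiv_radialField_zero h0)
    (fun z hz => hf.starForm_nonpos hα0 hα h0 hβ hβ1 hαβ hz) (mem_ball_zero_iff.2 hz)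
  refine re_bounds_of_norm_le (norm_nonneg z) hz rfl (by linarith) (by linarith) ?_
  rw [one_mul] at h
  simpa using h

/-- For `g = 1 - κ` and `σ = ±1` the numerator contains `1 ± κr`, the factor in the bounds for `Re
⟨w, z⟩`; this fixes the exponent `2(1 - β)` when `κ = 2β - 1`. -/
theorem hasDerivWithinAt_log_sub_mul_log {r : ℝ → ℝ} {r' g σ t : ℝ} {S : Set ℝ}
    (hr : HasDerivWithinAt r r' S t) (h0 : 0 < r t) (h1 : 0 < 1 + σ * r t) :
    HasDerivWithinAt (fun t => Real.log (r t) - g * Real.log (1 + σ * r t))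
      (r' * (1 + σ * ((1 - g) * r t)) / (r t * (1 + σ * r t))) S t := by
  have ha := hr.log h0.ne'
  have hb := (((hr.const_mul σ).const_add 1).log h1.ne').const_mul g
  convert! ha.sub hb using 1
  field_simp
  ring

theorem hasDerivWithinAt_norm_sq_of_flow {X : Type*} [NormedAddCommGroup X]
    [InnerProductSpace ℂ X] {γ : ℝ → X} {v : X} {S : Set ℝ} {t : ℝ}
    (hγ : HasDerivWithinAt γ ((-1 : ℝ) • v) S t) :
    HasDerivWithinAt (fun t => ‖γ t‖ ^ 2) (-2 * (inner ℂ (γ t) v).re) S t := by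
  let := InnerProductSpace.rclikeToReal ℂ X
  have h := hγ.norm_sq
  convert! h using 1
  rw [inner_smul_right, real_inner_eq_re_inner ℂ]
  simp

section

variable {X : Type*} [NormedAddCommGroup X] [InnerProductSpace ℂ X] {w : X → X} {κ τ : ℝ}
  {γ : ℝ → X}

theorem inward_flow_bounds (hκ0 : 0 ≤ κ) (hκ : κ < 1) (hτ : 0 ≤ τ)
    (hw : ∀ z, ‖z‖ < 1 → ‖z‖ ^ 2 * (1 - ‖z‖) ≤ (1 - κ * ‖z‖) * (inner ℂ z (w z)).re ∧
      (1 + κ * ‖z‖) * (inner ℂ z (w z)).re ≤ ‖z‖ ^ 2 * (1 + ‖z‖))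
    (hγ : ∀ t ∈ Icc 0 τ, γ t ∈ ball (0 : X) 1 ∧
      HasDerivWithinAt γ ((-1 : ℝ) • w (γ t)) (Icc 0 τ) t) (h0 : γ 0 ≠ 0) :
    γ τ ≠ 0 ∧ ‖γ τ‖ ≤ ‖γ 0‖ ∧
      Real.log ‖γ 0‖ - (1 - κ) * Real.log (1 + ‖γ 0‖) ≤
        τ + (Real.log ‖γ τ‖ - (1 - κ) * Real.log (1 + ‖γ τ‖)) ∧
      τ + (Real.log ‖γ τ‖ - (1 - κ) * Real.log (1 - ‖γ τ‖)) ≤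
        Real.log ‖γ 0‖ - (1 - κ) * Real.log (1 - ‖γ 0‖) := by
  have hlt : ∀ t ∈ Icc 0 τ, ‖γ t‖ < 1 := fun t ht => mem_ball_zero_iff.1 (hγ t ht).1
  have hκr : ∀ t ∈ Icc 0 τ, κ * ‖γ t‖ < 1 := fun t ht => by
    nlinarith [hlt t ht, norm_nonneg (γ t)]
  have hre0 : ∀ t ∈ Icc 0 τ, 0 ≤ (inner ℂ (γ t) (w (γ t))).re := fun t ht => by
    have h1 := (hw _ (hlt t ht)).1
    have h2 : 0 ≤ ‖γ t‖ ^ 2 * (1 - ‖γ t‖) := by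
      have := hlt t ht
      have : 0 ≤ 1 - ‖γ t‖ := by linarith
      positivity
    exact nonneg_of_mul_nonneg_right (h2.trans h1) (by linarith [hκr t ht])
  have hre2 : ∀ t ∈ Icc 0 τ, (inner ℂ (γ t) (w (γ t))).re ≤ 2 * ‖γ t‖ ^ 2 := fun t ht => by
    have h1 := (hw _ (hlt t ht)).2
    have h2 : 0 ≤ κ * ‖γ t‖ * (inner ℂ (γ t) (w (γ t))).re :=
      mul_nonneg (by positivity) (hre0 t ht)
    nlinarith [hlt t ht, sq_nonneg ‖γ t‖]
  have hsq : ∀ t ∈ Icc 0 τ, HasDerivWithinAt (fun t => ‖γ t‖ ^ 2)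
      (-2 * (inner ℂ (γ t) (w (γ t))).re) (Icc 0 τ) t := fun t ht =>
    hasDerivWithinAt_norm_sq_of_flow (hγ t ht).2
  have h0m : (0 : ℝ) ∈ Icc 0 τ := left_mem_Icc.2 hτ
  have hτm : τ ∈ Icc 0 τ := right_mem_Icc.2 hτ
  have hmono : ∀ {F F' : ℝ → ℝ}, (∀ t ∈ Icc 0 τ, HasDerivWithinAt F (F' t) (Icc 0 τ) t) →
      (∀ t ∈ Icc 0 τ, 0 ≤ F' t) → MonotoneOn F (Icc 0 τ) := fun {F F'} hF hF' =>
    monotoneOn_of_hasDerivWithinAt_nonneg (convex_Icc 0 τ)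
      (fun t ht => (hF t ht).continuousWithinAt)
      (fun t ht => (hF t (interior_subset ht)).mono interior_subset)
      (fun t ht => hF' t (interior_subset ht))
  have hne : ∀ t ∈ Icc 0 τ, γ t ≠ 0 := by
    -- As `Re ⟨w(z), z⟩ ≤ 2‖z‖²`, this weighted square cannot decrease, so the orbit never reaches
    -- `0` and the logarithms stay meaningful.
    have hm : MonotoneOn (fun t => Real.exp (4 * t) * ‖γ t‖ ^ 2) (Icc 0 τ) := by
      refine hmono (fun t ht => (((hasDerivAt_id t).const_mul 4).exp.hasDerivWithinAt).mul
        (hsq t ht)) fun t ht => ?_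
      have := hre2 t ht
      have h3 := Real.exp_pos (4 * t)
      have : 0 ≤ Real.exp (4 * t) * (4 * ‖γ t‖ ^ 2 - 2 * (inner ℂ (γ t) (w (γ t))).re) :=
        mul_nonneg h3.le (by linarith)
      simp only [id, mul_one]
      nlinarith only [this]
    intro t ht hz
    have := hm h0m ht ht.1
    simp only [hz, mul_zero, Real.exp_zero, norm_zero, one_mul] at this
    have h5 : 0 < ‖γ 0‖ := norm_pos_iff.2 h0
    nlinarith
  have hder : ∀ t ∈ Icc 0 τ, HasDerivWithinAt (fun t => ‖γ t‖)
      (-(inner ℂ (γ t) (w (γ t))).re / ‖γ t‖) (Icc 0 τ) t := fun t ht => by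
    have h5 : 0 < ‖γ t‖ := norm_pos_iff.2 (hne t ht)
    have := (hsq t ht).sqrt (by positivity)
    simp only [Real.sqrt_sq (norm_nonneg _)] at this
    convert! this using 1
    field_simp
  have hplus : ∀ t ∈ Icc 0 τ, HasDerivWithinAt
      (fun t => t + (Real.log ‖γ t‖ - (1 - κ) * Real.log (1 + 1 * ‖γ t‖)))
      (1 + -(inner ℂ (γ t) (w (γ t))).re / ‖γ t‖ * (1 + 1 * ((1 - (1 - κ)) * ‖γ t‖)) /
        (‖γ t‖ * (1 + 1 * ‖γ t‖))) (Icc 0 τ) t := fun t ht =>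
    (hasDerivWithinAt_id t _).add (hasDerivWithinAt_log_sub_mul_log (hder t ht)
      (norm_pos_iff.2 (hne t ht)) (by positivity))
  have hminus : ∀ t ∈ Icc 0 τ, HasDerivWithinAt
      (fun t => t + (Real.log ‖γ t‖ - (1 - κ) * Real.log (1 + (-1) * ‖γ t‖)))
      (1 + -(inner ℂ (γ t) (w (γ t))).re / ‖γ t‖ * (1 + (-1) * ((1 - (1 - κ)) * ‖γ t‖)) /
        (‖γ t‖ * (1 + (-1) * ‖γ t‖))) (Icc 0 τ) t := fun t ht =>
    (hasDerivWithinAt_id t _).add (hasDerivWithinAt_log_sub_mul_log (hder t ht)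
      (norm_pos_iff.2 (hne t ht)) (by linarith [hlt t ht]))
  refine ⟨hne τ hτm, ?_, ?_, ?_⟩
  · have := hmono (fun t ht => (hder t ht).neg) (fun t ht => by
      have := hre0 t ht
      rw [neg_div, neg_neg]; positivity) h0m hτm hτ
    exact neg_le_neg_iff.1 this
  · have := hmono hplus (fun t ht => by
      have h5 : 0 < ‖γ t‖ := norm_pos_iff.2 (hne t ht)
      have h6 := (hw _ (hlt t ht)).2
      have : 1 + -(inner ℂ (γ t) (w (γ t))).re / ‖γ t‖ * (1 + 1 * ((1 - (1 - κ)) * ‖γ t‖)) /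
        (‖γ t‖ * (1 + 1 * ‖γ t‖)) = (‖γ t‖ ^ 2 * (1 + ‖γ t‖) -
          (1 + κ * ‖γ t‖) * (inner ℂ (γ t) (w (γ t))).re) / (‖γ t‖ ^ 2 * (1 + ‖γ t‖)) := by
        field_simp
        ring
      rw [this]
      exact div_nonneg (by linarith) (by positivity)) h0m hτm hτ
    simpa using this
  · have := hmono (fun t ht => (hminus t ht).neg) (fun t ht => by
      have h5 : 0 < ‖γ t‖ := norm_pos_iff.2 (hne t ht)
      have h6 := (hw _ (hlt t ht)).1
      have h7 : 0 < 1 - ‖γ t‖ := by linarith [hlt t ht]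
      have : -(1 + -(inner ℂ (γ t) (w (γ t))).re / ‖γ t‖ * (1 + (-1) * ((1 - (1 - κ)) * ‖γ t‖)) /
        (‖γ t‖ * (1 + (-1) * ‖γ t‖))) = ((1 - κ * ‖γ t‖) * (inner ℂ (γ t) (w (γ t))).re -
          ‖γ t‖ ^ 2 * (1 - ‖γ t‖)) / (‖γ t‖ ^ 2 * (1 - ‖γ t‖)) := by
        rw [show 1 + (-1) * ‖γ t‖ = 1 - ‖γ t‖ by ring]
        field_simp
        ring
      rw [this]
      exact div_nonneg (by linarith) (by positivity)) h0m hτm hτ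
    have := neg_le_neg_iff.1 this
    simpa [← sub_eq_add_neg] using this

end

theorem exp_log_sub_mul_log {r g q : ℝ} (hr : 0 < r) (hq : 0 < q) :
    Real.exp (Real.log r - g * Real.log q) = r / q ^ g := by
  rw [Real.exp_sub, Real.exp_log hr, Real.rpow_def_of_pos hq, mul_comm g]

theorem eventually_norm_bounds_of_hasFDerivAt_id {X : Type*} [NormedAddCommGroup X]
    [NormedSpace ℂ X] {f : X → X} (hf : HasFDerivAt f (ContinuousLinearMap.id ℂ X) 0)
    (h0 : f 0 = 0) {ε : ℝ} (hε : 0 < ε) :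
    ∀ᶠ z in 𝓝 (0 : X), (1 - ε) * ‖z‖ ≤ ‖f z‖ ∧ ‖f z‖ ≤ (1 + ε) * ‖z‖ := by
  filter_upwards [hf.isLittleO.bound hε] with z hz
  simp only [h0, sub_zero, ContinuousLinearMap.id_apply] at hz
  have h1 := norm_sub_norm_le z (f z)
  have h2 := norm_sub_norm_le (f z) z
  rw [norm_sub_rev] at h1
  constructor <;> linarith

/-- Growth bounds for a map which is contracted along the inward flow of a vector field with
two-sided radial bounds. -/
theorem norm_bounds_of_inward_step {X : Type*} [NormedAddCommGroup X] [NormedSpace ℂ X]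
    {f : X → X} (hf : HasFDerivAt f (ContinuousLinearMap.id ℂ X) 0) (h0 : f 0 = 0) {g τ : ℝ}
    (hg : 0 ≤ g) (hτ : 0 < τ) {z : X} (hz : z ≠ 0) (hz1 : ‖z‖ < 1)
    (hstep : ∀ u : X, u ≠ 0 → ‖u‖ ≤ ‖z‖ → ∃ v : X, v ≠ 0 ∧ ‖v‖ ≤ ‖u‖ ∧
      f v = Real.exp (-τ) • f u ∧
      Real.log ‖u‖ - g * Real.log (1 + ‖u‖) ≤ τ + (Real.log ‖v‖ - g * Real.log (1 + ‖v‖)) ∧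
      τ + (Real.log ‖v‖ - g * Real.log (1 - ‖v‖)) ≤ Real.log ‖u‖ - g * Real.log (1 - ‖u‖)) :
    ‖z‖ / (1 + ‖z‖) ^ g ≤ ‖f z‖ ∧ ‖f z‖ ≤ ‖z‖ / (1 - ‖z‖) ^ g := by
  have hzpos : 0 < ‖z‖ := norm_pos_iff.2 hz
  set A := ‖z‖ / (1 + ‖z‖) ^ g with hA
  set C := ‖z‖ / (1 - ‖z‖) ^ g with hC
  -- The inward orbit never leaves the ball of radius `‖z‖`, so the step of length `τ` can be
  -- repeated indefinitely.
  have hiter : ∀ k : ℕ, ∃ v : X, v ≠ 0 ∧ ‖v‖ ≤ ‖z‖ ∧ f v = Real.exp (-(k * τ)) • f z ∧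
      Real.log ‖z‖ - g * Real.log (1 + ‖z‖) ≤
        k * τ + (Real.log ‖v‖ - g * Real.log (1 + ‖v‖)) ∧
      k * τ + (Real.log ‖v‖ - g * Real.log (1 - ‖v‖)) ≤
        Real.log ‖z‖ - g * Real.log (1 - ‖z‖) := by
    intro k
    induction k with
    | zero => exact ⟨z, hz, le_rfl, by simp, by simp, by simp⟩
    | succ k ih =>
      obtain ⟨u, hu0, huz, hfu, hu1, hu2⟩ := ih
      obtain ⟨v, hv0, hvu, hfv, hv1, hv2⟩ := hstep u hu0 huz
      refine ⟨v, hv0, hvu.trans huz, ?_, ?_, ?_⟩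
      · rw [hfv, hfu, smul_smul, ← Real.exp_add]
        congr 2
        push_cast; ring
      · push_cast; linarith
      · push_cast; linarith
  choose v hv0 hvz hfv hv1 hv2 using hiter
  have hlow : ∀ k : ℕ, A ≤ Real.exp (k * τ) * ‖v k‖ := fun k => by
    rw [hA, ← exp_log_sub_mul_log hzpos (by positivity),
      ← Real.exp_log (norm_pos_iff.2 (hv0 k)), ← Real.exp_add, Real.exp_le_exp]
    have := mul_nonneg hg (Real.log_nonneg (show 1 ≤ 1 + ‖v k‖ by linarith [norm_nonneg (v k)]))
    linarith [hv1 k]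
  have hup : ∀ k : ℕ, Real.exp (k * τ) * ‖v k‖ ≤ C := fun k => by
    rw [hC, ← exp_log_sub_mul_log hzpos (by linarith),
      ← Real.exp_log (norm_pos_iff.2 (hv0 k)), ← Real.exp_add, Real.exp_le_exp]
    have := mul_nonneg hg (neg_nonneg.2 (Real.log_nonpos
      (show 0 ≤ 1 - ‖v k‖ by linarith [hvz k]) (by linarith [norm_nonneg (v k)])))
    linarith [hv2 k]
  have hexp : ∀ k : ℕ, Real.exp (k * τ) * Real.exp (-(k * τ)) = 1 := fun k => by
    rw [← Real.exp_add]; simp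
  have hfn : ∀ k : ℕ, Real.exp (k * τ) * ‖f (v k)‖ = ‖f z‖ := fun k => by
    rw [hfv, norm_smul, Real.norm_of_nonneg (Real.exp_pos _).le, ← mul_assoc, hexp, one_mul]
  -- The orbit shrinks like `e^(-kτ)` and tends to `0`, where `‖f v‖ / ‖v‖ → 1`; this converts
  -- bounds on the orbit into bounds on `‖f z‖`.
  have hlim : Tendsto v atTop (𝓝 0) := by
    have h1 : Tendsto (fun k : ℕ => C * Real.exp (-(k * τ))) atTop (𝓝 0) := by
      have : Tendsto (fun k : ℕ => (k : ℝ) * τ) atTop atTop :=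
        tendsto_natCast_atTop_atTop.atTop_mul_const hτ
      simpa using (Real.tendsto_exp_neg_atTop_nhds_zero.comp this).const_mul C
    refine squeeze_zero_norm (fun k => ?_) h1
    calc ‖v k‖ = Real.exp (k * τ) * ‖v k‖ * Real.exp (-(k * τ)) := by
          rw [mul_right_comm, hexp, one_mul]
      _ ≤ _ := by gcongr; exact hup k
  have hε : ∀ ε > 0, (1 - ε) * A ≤ ‖f z‖ ∧ ‖f z‖ ≤ (1 + ε) * C := fun ε hε => by
    have hnn : 0 ≤ A := by positivity
    obtain ⟨k, hk1, hk2⟩ :=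
      (hlim.eventually (eventually_norm_bounds_of_hasFDerivAt_id hf h0 hε)).exists
    have hpos := Real.exp_pos (k * τ)
    constructor
    · obtain hε1 | hε1 := le_total 1 ε
      · exact (mul_nonpos_of_nonpos_of_nonneg (by linarith) hnn).trans (norm_nonneg _)
      · rw [← hfn k]
        calc (1 - ε) * A ≤ (1 - ε) * (Real.exp (k * τ) * ‖v k‖) :=
              mul_le_mul_of_nonneg_left (hlow k) (by linarith)
          _ = Real.exp (k * τ) * ((1 - ε) * ‖v k‖) := by ring
          _ ≤ _ := by gcongr
    · rw [← hfn k]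
      calc Real.exp (k * τ) * ‖f (v k)‖ ≤ Real.exp (k * τ) * ((1 + ε) * ‖v k‖) := by gcongr
        _ = (1 + ε) * (Real.exp (k * τ) * ‖v k‖) := by ring
        _ ≤ _ := by gcongr; exact hup k
  constructor
  · have h : Tendsto (fun ε : ℝ => (1 - ε) * A) (𝓝[>] 0) (𝓝 ((1 - 0) * A)) :=
      tendsto_nhdsWithin_of_tendsto_nhds (Continuous.tendsto (by fun_prop) 0)
    rw [sub_zero, one_mul] at h
    exact le_of_tendsto h (eventually_nhdsWithin_of_forall fun ε h => (hε ε h).1)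
  · have h : Tendsto (fun ε : ℝ => (1 + ε) * C) (𝓝[>] 0) (𝓝 ((1 + 0) * C)) :=
      tendsto_nhdsWithin_of_tendsto_nhds (Continuous.tendsto (by fun_prop) 0)
    rw [add_zero, one_mul] at h
    exact ge_of_tendsto h (eventually_nhdsWithin_of_forall fun ε h => (hε ε h).2)

section

variable {X : Type*} [NormedAddCommGroup X] [InnerProductSpace ℂ X] [CompleteSpace X]
  {α β : ℝ} {f : X → X}

theorem IsConvexOfOrder.exists_radialField_flow (hf : IsConvexOfOrder α f) (hα : α < 1)
    (h0 : f 0 = 0) {ρ : ℝ} (hρ : ρ < 1) :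
    ∃ τ > 0, ∀ z : X, ‖z‖ ≤ ρ → ∀ c : ℝ, |c| ≤ 1 → ∃ γ : ℝ → X, γ 0 = z ∧
      ∀ t ∈ Icc 0 τ, γ t ∈ ball 0 1 ∧
        HasDerivWithinAt γ (c • radialField f (γ t)) (Icc 0 τ) t :=
  exists_flow hf.1.differentiableOn_radialField
    (fun _ h => hf.exists_norm_radialField_le hα h0 h) hρ

theorem IsConvexOfOrder.growth (hf : IsConvexOfOrder α f)
    (hα0 : 0 ≤ α) (hα : α < 1) (h0 : f 0 = 0) (hD : fderiv ℂ f 0 = ContinuousLinearMap.id ℂ X)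
    (hβ : 1 / 2 ≤ β) (hβ1 : β < 1) (hαβ : 2 * β ^ 2 - (2 * α - 1) * β - 1 = 0) {z : X}
    (hz : ‖z‖ < 1) :
    ‖z‖ / (1 + ‖z‖) ^ (2 * (1 - β)) ≤ ‖f z‖ ∧ ‖f z‖ ≤ ‖z‖ / (1 - ‖z‖) ^ (2 * (1 - β)) := by
  obtain rfl | hz0 := eq_or_ne z 0
  · simp [h0]
  have hd : HasFDerivAt f (ContinuousLinearMap.id ℂ X) 0 := by
    rw [← hD]
    exact (hf.1.differentiableOn.differentiableAt
      (isOpen_ball.mem_nhds (mem_ball_self one_pos))).hasFDerivAt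
  obtain ⟨τ, hτ, H⟩ := hf.exists_radialField_flow hα h0 hz
  refine norm_bounds_of_inward_step hd h0 (by linarith) hτ hz0 hz fun u hu0 hu => ?_
  obtain ⟨γ, rfl, hγ⟩ := H u hu (-1) (by simp)
  have hb := inward_flow_bounds (κ := 2 * β - 1) (by linarith) (by linarith) hτ.le
    (fun v hv => hf.re_inner_radialField_bounds hα0 hα h0 hβ hβ1 hαβ hv) hγ hu0
  rw [show 1 - (2 * β - 1) = 2 * (1 - β) by ring] at hb
  have he := exp_smul_eq_of_flow hf.1 hτ.le hγ
  rw [neg_one_mul] at he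
  exact ⟨γ τ, hb.1, hb.2.1, he, hb.2.2⟩

end

/-! ### Covering. -/

theorem div_one_add_rpow_mono {g x y : ℝ} (hg0 : 0 ≤ g) (hg : g ≤ 1) (hx : 0 < x) (hxy : x ≤ y) :
    x / (1 + x) ^ g ≤ y / (1 + y) ^ g := by
  -- Both factors on the right increase with `t` because `0 ≤ g ≤ 1`.
  have h : ∀ t : ℝ, 0 < t → t / (1 + t) ^ g = (t / (1 + t)) ^ g * t ^ (1 - g) := fun t ht => by
    rw [Real.div_rpow ht.le (by positivity), div_mul_eq_mul_div, ← Real.rpow_add ht]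
    simp
  have hy := hx.trans_le hxy
  rw [h x hx, h y hy]
  have h1 : x / (1 + x) ≤ y / (1 + y) := by
    rw [div_le_div_iff₀ (by positivity) (by positivity)]
    linarith
  have h2 : 0 ≤ 1 - g := by linarith
  gcongr

theorem exists_lt_one_lt_div_one_add_rpow {g b : ℝ} (hb : b < 1 / (2 : ℝ) ^ g) :
    ∃ r, 0 < r ∧ r < 1 ∧ b < r / (1 + r) ^ g := by
  have hc : ContinuousAt (fun r : ℝ => r / (1 + r) ^ g) 1 := by
    refine ContinuousAt.div (by fun_prop) ?_ (by positivity)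
    exact ContinuousAt.rpow_const (by fun_prop) (Or.inl (by norm_num))
  have h1 : b < 1 / (1 + 1 : ℝ) ^ g := by norm_num; simpa using hb
  have h2 : ∀ᶠ r in 𝓝[<] (1 : ℝ), b < r / (1 + r) ^ g :=
    (hc.eventually (lt_mem_nhds h1)).filter_mono nhdsWithin_le_nhds
  obtain ⟨r, hr, hr0⟩ := (h2.and (Ioo_mem_nhdsLT (zero_lt_one' ℝ))).exists
  exact ⟨r, hr0.1, hr0.2, hr⟩

/-- If the points of the ball mapped into a ball of radius `b` stay away from the boundary,
then the outward flow of the radial field covers that ball. -/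
theorem mem_image_of_norm_lt {X : Type*} [NormedAddCommGroup X] [NormedSpace ℂ X] {f : X → X}
    (hf : IsLocallyBiholomorphicOn f (ball (0 : X) 1)) (h0 : f 0 = 0) {τ b : ℝ} (hτ : 0 < τ)
    (hstep : ∀ z ∈ ball (0 : X) 1, ‖f z‖ ≤ b → ∃ v ∈ ball (0 : X) 1, f v = Real.exp τ • f z)
    {y : X} (hy : ‖y‖ ≤ b) : y ∈ f '' ball (0 : X) 1 := by
  have hn := hf.image_mem_nhds (mem_ball_self one_pos)
  rw [h0] at hn
  obtain ⟨δ, hδ, hsub⟩ := Metric.mem_nhds_iff.1 hn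
  -- Each outward step multiplies the radius of the covered ball by `e^τ`, as long as it stays below
  -- `b`; the start is a ball of radius `δ` given by openness of `f` at `0`.
  have key : ∀ k : ℕ, ∀ y : X, ‖y‖ ≤ b → ‖y‖ < Real.exp (k * τ) * δ →
      y ∈ f '' ball (0 : X) 1 := by
    intro k
    induction k with
    | zero =>
      intro y _ hy
      exact hsub (by simpa using hy)
    | succ k ih =>
      intro y hyb hyk
      have hnorm : ‖Real.exp (-τ) • y‖ = Real.exp (-τ) * ‖y‖ := by
        rw [norm_smul, Real.norm_of_nonneg (Real.exp_pos _).le]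
      have hle : Real.exp (-τ) ≤ 1 := Real.exp_le_one_iff.2 (by linarith)
      have hb : ‖Real.exp (-τ) • y‖ ≤ b := by
        rw [hnorm]
        nlinarith [norm_nonneg y]
      obtain ⟨u, hu, hfu⟩ := ih (Real.exp (-τ) • y) hb (by
        rw [hnorm]
        calc Real.exp (-τ) * ‖y‖ < Real.exp (-τ) * (Real.exp ((k + 1 : ℕ) * τ) * δ) := by gcongr
          _ = _ := by
            rw [← mul_assoc, ← Real.exp_add]
            congr 2
            push_cast; ring)
      obtain ⟨v, hv, hfv⟩ := hstep u hu (by rw [hfu]; exact hb)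
      refine ⟨v, hv, ?_⟩
      rw [hfv, hfu, smul_smul, ← Real.exp_add]
      simp
  have hlim : Tendsto (fun k : ℕ => Real.exp (k * τ) * δ) atTop atTop :=
    (Real.tendsto_exp_atTop.comp
      (tendsto_natCast_atTop_atTop.atTop_mul_const hτ)).atTop_mul_const hδ
  obtain ⟨k, hk⟩ := (hlim.eventually (eventually_gt_atTop ‖y‖)).exists
  exact key k y hy hk

theorem IsConvexOfOrder.ball_subset_image {X : Type*} [NormedAddCommGroup X]
    [InnerProductSpace ℂ X] [CompleteSpace X] {α β : ℝ} {f : X → X} (hf : IsConvexOfOrder α f)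
    (hα0 : 0 ≤ α) (hα : α < 1) (h0 : f 0 = 0) (hD : fderiv ℂ f 0 = ContinuousLinearMap.id ℂ X)
    (hβ : 1 / 2 ≤ β) (hβ1 : β < 1) (hαβ : 2 * β ^ 2 - (2 * α - 1) * β - 1 = 0) :
    ball (0 : X) (1 / (2 : ℝ) ^ (2 * (1 - β))) ⊆ f '' ball (0 : X) 1 := by
  intro y hy
  obtain ⟨r, hr0, hr1, hyr⟩ := exists_lt_one_lt_div_one_add_rpow (mem_ball_zero_iff.1 hy)
  obtain ⟨τ, hτ, H⟩ := hf.exists_radialField_flow hα h0 hr1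
  refine mem_image_of_norm_lt hf.1 h0 hτ (fun z hz hzy => ?_) le_rfl
  -- By the lower growth bound, `‖z‖ > r` would force `‖f z‖ > ‖y‖`. Hence all relevant preimages
  -- lie in one smaller ball, with a common flow time `τ`.
  have hzr : ‖z‖ ≤ r := by
    by_contra! hc
    have h1 := (hf.growth hα0 hα h0 hD hβ hβ1 hαβ (mem_ball_zero_iff.1 hz)).1
    have h2 := div_one_add_rpow_mono (g := 2 * (1 - β)) (by linarith) (by linarith) hr0 hc.le
    linarith
  obtain ⟨γ, rfl, hγ⟩ := H z hzr 1 (by simp)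
  refine ⟨γ τ, (hγ τ (right_mem_Icc.2 hτ.le)).1, ?_⟩
  simpa using exp_smul_eq_of_flow hf.1 hτ.le hγ

end HilbertConvex

theorem corollary3 {X : Type*} [NormedAddCommGroup X] [InnerProductSpace ℂ X] [CompleteSpace X]
    (α : ℝ) (hα0 : 0 ≤ α) (hα1 : α < 1) (f : X → X) (hf : f ∈ HilbertConvex.classK X α) :
    (∀ z ∈ Metric.ball (0 : X) 1,
      ‖z‖ / (1 + ‖z‖) ^ (2 * (1 - HilbertConvex.betaOrder α)) ≤ ‖f z‖ ∧
        ‖f z‖ ≤ ‖z‖ / (1 - ‖z‖) ^ (2 * (1 - HilbertConvex.betaOrder α))) ∧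
      Metric.ball (0 : X) (1 / (2 : ℝ) ^ (2 * (1 - HilbertConvex.betaOrder α))) ⊆
        f '' Metric.ball (0 : X) 1 := by
  obtain ⟨hconv, h0, hD⟩ := hf
  obtain ⟨hβ, hβ1, hαβ⟩ := HilbertConvex.betaOrder_spec hα0 hα1
  exact ⟨fun z hz => hconv.growth hα0 hα1 h0 hD hβ hβ1 hαβ (mem_ball_zero_iff.1 hz),
    hconv.ball_subset_image hα0 hα1 h0 hD hβ hβ1 hαβ⟩
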